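/- Let $r\ge 1$ and let $\Lambda$ be a higher rank graph of rank $r$, i.e. a small category with a shape functor $\sigma:\Lambda\to\mathbb N^r$ having the unique factorization property: if $\sigma(\alpha)=m+n$, there are unique $\lambda,\mu$ with $\alpha=\lambda\mu$, $\sigma(\lambda)=m$, $\sigma(\mu)=n$. Write $s(\lambda)$, $t(\lambda)$ for the source and the terminal object of $\lambda$; $\lambda\mu$ is defined when $s(\lambda)=t(\mu)$. Assume condition (F): for every $n\in\mathbb N^r$ the set of morphisms of shape $n$ is non-empty and finite, and for every object $v$ so are the sets of morphisms of shape $n$ that end at $v$ and that start from $v$. Let $\Lambda^*$ be the set of morphisms of non-zero shape and $\overline\Lambda=\{\Omega\}\cup\Lambda^*$, where $\Omega\notin\Lambda^*$ is an additional symbol. For $\lambda\in\Lambda^*$ let $L_\lambda,R_\lambda$ be the partial isometries of $\ell^2(\overline\Lambda)$ with $L_\lambda\delta_\Omega=R_\lambda\delta_\Omega=\delta_\lambda$ and, for $\mu\in\Lambda^*$, $L_\lambda\delta_\mu=\delta_{\lambda\mu}$ if $s(\lambda)=t(\mu)$ and $0$ otherwise, $R_\lambda\delta_\mu=\delta_{\mu\lambda}$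 if $s(\mu)=t(\lambda)$ and $0$ otherwise. For an object $a$ let $L_a$ and $R_a$ be the projections onto the closed span of $\delta_\Omega$ and the $\delta_\mu$ with $t(\mu)=a$, respectively $s(\mu)=a$. Let $\mathcal E=C^*(L_\lambda,R_\lambda:\lambda\in\Lambda^*)$ be the two-sided Toeplitz algebra (the generated C*-algebra, no unit being adjoined) and let $X$ be the Gelfand spectrum of $\mathcal E\cap\ell^\infty(\overline\Lambda)$, where $\ell^\infty(\overline\Lambda)$ is the algebra of diagonal operators. Each $\mu\in\overline\Lambda$ gives the point $T\mapsto\langle T\delta_\mu,\delta_\mu\rangle$ of $X$. For $V=L_\lambda$ or $V=R_\lambda$, $\lambda\in\Lambda$ (objects included), let $l_\lambda$, respectively $r_\lambda$, be the partial homeomorphism of $X$ defined on $\{x: x(V^*V)\neq0\}$ that sends $x$ to the character $f\mapsto x(V^*fV)$. Let $G$ be the groupoid of germs of the pseudogroup generated by all $l_\lambda,r_\lambda$ (the smallest set of partial homeomorphisms that contains them and the identity and is closed under composition and inversion), with the quotient of the topology of $\bigsqcup_S \mathrm{dom}(S)$. Let $C_c(G)$ be the linear span of the functions that, for some open bisection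 $U$, are continuous on $U$ and vanish outside a compact subset of $U$ ($G$ need not be Hausdorff), and let $C^*_r(G)$ be the completion of $C_c(G)$ in the regular representation on $\bigoplus_{x\in X}\ell^2(G_x)$, where $G_x$ is the set of elements of $G$ with source $x$. Then: (i) $X$ is a compact Hausdorff space, the map $\overline\Lambda\to X$ is injective, and its image is an open, dense, discrete subset of $X$; thus $X$ is a compactification of $\overline\Lambda$. (ii) There is exactly one $*$-representation $\pi$ of $C^*_r(G)$ on $\ell^2(\overline\Lambda)$ that extends the canonical representation of the ideal of the open invariant set $\overline\Lambda\subset X$, i.e. such that $\pi(f)\delta_\mu=\sum_{\gamma\in G,\ s(\gamma)=\mu}f(\gamma)\,\delta_{r(\gamma)}$ for all $\mu\in\overline\Lambda$ and all $f\in C_c(G)$ supported in $G|_{\overline\Lambda}$; and its image is $\pi(C^*_r(G))=\mathcal E$. -/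

import Mathlib

open CategoryTheory

universe u v w

namespace TwoSidedToeplitz

noncomputable section

/-! ### Higher rank graphs -/

/-- A higher rank graph of rank `r`: a small category with a shape functor to `ℕ ^ r` with the
unique factorization property. A morphism `f : a ⟶ b` has source `s(f) = a` and terminal object
`t(f) = b`; the product `λ μ`, defined when `s(λ) = t(μ)`, is `μ ≫ λ`. -/
structure HigherRankGraph (r : ℕ) (V : Type u) [Category.{v} V] where
  shape : ∀ {a b : V}, (a ⟶ b) → (Fin r → ℕ)
  shape_id : ∀ a : V, shape (𝟙 a) = 0
  shape_comp : ∀ {a b c : V} (g : a ⟶ b) (f : b ⟶ c), shape (g ≫ f) = shape f + shape g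
  factorization : ∀ {a b : V} (f : a ⟶ b) (m n : Fin r → ℕ), shape f = m + n →
    ∃! p : (Σ c : V, (c ⟶ b) × (a ⟶ c)),
      shape p.2.1 = m ∧ shape p.2.2 = n ∧ p.2.2 ≫ p.2.1 = f

variable {r : ℕ} {V : Type u} [Category.{v} V]

namespace HigherRankGraph

/-- The finiteness condition (F): for every shape `n` the set of morphisms of shape `n` is
non-empty and finite, and so are the sets of those ending at, and starting from, a given object. -/
class IsFinitary (Λ : HigherRankGraph r V) : Prop where
  nonempty : ∀ n : Fin r → ℕ, {f : Arrow V | Λ.shape f.hom = n}.Nonempty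
  finite : ∀ n : Fin r → ℕ, {f : Arrow V | Λ.shape f.hom = n}.Finite
  nonempty_into : ∀ (n : Fin r → ℕ) (x : V),
    {f : Arrow V | Λ.shape f.hom = n ∧ f.right = x}.Nonempty
  finite_into : ∀ (n : Fin r → ℕ) (x : V),
    {f : Arrow V | Λ.shape f.hom = n ∧ f.right = x}.Finite
  nonempty_from : ∀ (n : Fin r → ℕ) (x : V),
    {f : Arrow V | Λ.shape f.hom = n ∧ f.left = x}.Nonempty
  finite_from : ∀ (n : Fin r → ℕ) (x : V),
    {f : Arrow V | Λ.shape f.hom = n ∧ f.left = x}.Finite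

/-- The set `Λ̄ = {Ω} ∪ Λ*`: the vacuum `Ω` and the morphisms of non-zero shape. -/
inductive Bar (Λ : HigherRankGraph r V) : Type (max u v)
  | vac : Bar Λ
  | mor {a b : V} (f : a ⟶ b) (hf : Λ.shape f ≠ 0) : Bar Λ

variable (Λ : HigherRankGraph r V)

open scoped Classical in
/-- A morphism as an element of `Λ̄`; morphisms of shape zero (the objects) give `Ω`. -/
def toBar {a b : V} (f : a ⟶ b) : Bar Λ :=
  if hf : Λ.shape f = 0 then Bar.vac else Bar.mor f hf

open scoped Classical in
/-- The partial map `μ ↦ λ μ` of `Λ̄`, defined on `Ω` and on the `μ` with `s(λ) = t(μ)`,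
with `λ Ω = λ` (and `λ Ω = Ω` if `λ` is an object). -/
def leftFun {a b : V} (f : a ⟶ b) : Bar Λ → Option (Bar Λ)
  | Bar.vac => some (Λ.toBar f)
  | Bar.mor (b := d) g _ => if h : d = a then some (Λ.toBar (g ≫ eqToHom h ≫ f)) else none

open scoped Classical in
/-- The partial map `μ ↦ μ λ` of `Λ̄`, defined on `Ω` and on the `μ` with `s(μ) = t(λ)`,
with `Ω λ = λ` (and `Ω λ = Ω` if `λ` is an object). -/
def rightFun {a b : V} (f : a ⟶ b) : Bar Λ → Option (Bar Λ)
  | Bar.vac => some (Λ.toBar f)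
  | Bar.mor (a := c) g _ => if h : b = c then some (Λ.toBar (f ≫ eqToHom h ≫ g)) else none

lemma comp_right_cancel (Λ : HigherRankGraph r V) {a b c : V} {f : b ⟶ c} {g g' : a ⟶ b} (h : g ≫ f = g' ≫ f) :
    g = g' := by
  have hs : Λ.shape g = Λ.shape g' := by
    have := congrArg Λ.shape h
    rw [Λ.shape_comp, Λ.shape_comp] at this
    exact add_left_cancel this
  have := (Λ.factorization (g ≫ f) _ _ (Λ.shape_comp g f)).unique
    (y₁ := ⟨b, f, g⟩) (y₂ := ⟨b, f, g'⟩) ⟨rfl, rfl, rfl⟩ ⟨rfl, hs.symm, h.symm⟩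
  simpa using this

lemma comp_left_cancel (Λ : HigherRankGraph r V) {a b c : V} {f : a ⟶ b} {g g' : b ⟶ c} (h : f ≫ g = f ≫ g') :
    g = g' := by
  have hs : Λ.shape g = Λ.shape g' := by
    have := congrArg Λ.shape h
    rw [Λ.shape_comp, Λ.shape_comp] at this
    exact add_right_cancel this
  have := (Λ.factorization (f ≫ g) _ _ (Λ.shape_comp f g)).unique
    (y₁ := ⟨b, g, f⟩) (y₂ := ⟨b, g', f⟩) ⟨rfl, rfl, rfl⟩ ⟨hs.symm, rfl, h.symm⟩
  simpa using this

lemma eq_eqToHom_of_shape_eq_zero {a b : V} {f : a ⟶ b} (hf : Λ.shape f = 0) :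
    ∃ h : a = b, f = eqToHom h := by
  have := (Λ.factorization f 0 0 (by simpa using hf)).unique
    (y₁ := ⟨b, 𝟙 b, f⟩) (y₂ := ⟨a, f, 𝟙 a⟩)
    ⟨Λ.shape_id b, hf, by simp⟩ ⟨hf, Λ.shape_id a, by simp⟩
  obtain ⟨rfl, h⟩ := Sigma.mk.inj_iff.1 this
  refine ⟨rfl, ?_⟩
  have := (Prod.mk.inj (eq_of_heq h)).2
  simpa using this

lemma toBar_of_ne {a b : V} {f : a ⟶ b} (hf : Λ.shape f ≠ 0) : Λ.toBar f = Bar.mor f hf :=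
  dif_neg hf

lemma toBar_of_eq {a b : V} {f : a ⟶ b} (hf : Λ.shape f = 0) : Λ.toBar f = Bar.vac :=
  dif_pos hf

lemma shape_eq_of_toBar_eq {a b c d : V} {f : a ⟶ b} {g : c ⟶ d} (h : Λ.toBar f = Λ.toBar g) :
    Λ.shape f = Λ.shape g := by
  unfold toBar at h
  split_ifs at h with h₁ h₂ h₂
  · rw [h₁, h₂]
  · cases h
    rfl

lemma shape_comp_ne {a b c : V} {f : b ⟶ c} {g : a ⟶ b}
    (h : Λ.shape f ≠ 0 ∨ Λ.shape g ≠ 0) : Λ.shape (g ≫ f) ≠ 0 := by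
  rw [Λ.shape_comp]
  intro h0
  rw [add_eq_zero] at h0
  tauto

lemma leftFun_injective {a b : V} (f : a ⟶ b) (x y z : Bar Λ) (hx : Λ.leftFun f x = some z)
    (hy : Λ.leftFun f y = some z) : x = y := by
  cases x with
  | vac =>
    cases y with
    | vac => rfl
    | mor g hg =>
      simp only [leftFun] at hx hy
      split_ifs at hy with h
      subst h
      have := shape_eq_of_toBar_eq Λ (Option.some.inj (hy.trans hx.symm))
      simp only [eqToHom_refl, Category.id_comp, Λ.shape_comp] at this
      exact absurd (by simpa using this) hg
  | mor g hg =>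
    cases y with
    | vac =>
      simp only [leftFun] at hx hy
      split_ifs at hx with h
      subst h
      have := shape_eq_of_toBar_eq Λ (Option.some.inj (hx.trans hy.symm))
      simp only [eqToHom_refl, Category.id_comp, Λ.shape_comp] at this
      exact absurd (by simpa using this) hg
    | mor g' hg' =>
      simp only [leftFun] at hx hy
      split_ifs at hx hy with h h'
      subst h
      subst h'
      have := Option.some.inj (hx.trans hy.symm)
      simp only [eqToHom_refl, Category.id_comp] at this
      rw [toBar_of_ne Λ (shape_comp_ne Λ (Or.inr hg)),
        toBar_of_ne Λ (shape_comp_ne Λ (Or.inr hg'))] at this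
      obtain ⟨rfl, -, h⟩ := Bar.mor.inj this
      obtain rfl := comp_right_cancel Λ (eq_of_heq h)
      rfl

lemma rightFun_injective {a b : V} (f : a ⟶ b) (x y z : Bar Λ) (hx : Λ.rightFun f x = some z)
    (hy : Λ.rightFun f y = some z) : x = y := by
  cases x with
  | vac =>
    cases y with
    | vac => rfl
    | mor g hg =>
      simp only [rightFun] at hx hy
      split_ifs at hy with h
      subst h
      have := shape_eq_of_toBar_eq Λ (Option.some.inj (hy.trans hx.symm))
      simp only [eqToHom_refl, Category.id_comp, Λ.shape_comp] at this
      exact absurd (by simpa using this) hg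
  | mor g hg =>
    cases y with
    | vac =>
      simp only [rightFun] at hx hy
      split_ifs at hx with h
      subst h
      have := shape_eq_of_toBar_eq Λ (Option.some.inj (hx.trans hy.symm))
      simp only [eqToHom_refl, Category.id_comp, Λ.shape_comp] at this
      exact absurd (by simpa using this) hg
    | mor g' hg' =>
      simp only [rightFun] at hx hy
      split_ifs at hx hy with h h'
      subst h
      subst h'
      have := Option.some.inj (hx.trans hy.symm)
      simp only [eqToHom_refl, Category.id_comp] at this
      rw [toBar_of_ne Λ (shape_comp_ne Λ (Or.inl hg)),
        toBar_of_ne Λ (shape_comp_ne Λ (Or.inl hg'))] at this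
      obtain ⟨-, rfl, h⟩ := Bar.mor.inj this
      obtain rfl := comp_left_cancel Λ (eq_of_heq h)
      rfl

end HigherRankGraph

/-! ### Partial bijections and operators on `ℓ²` -/

/-- A partial map which is injective on its domain, as a partial bijection. -/
def pequivOfInj {ι : Type w} (p : ι → Option ι)
    (hp : ∀ x y z, p x = some z → p y = some z → x = y) : ι ≃. ι where
  toFun := p
  invFun z := open scoped Classical in if h : ∃ x, p x = some z then some h.choose else none
  inv x z := by
    constructor
    · intro h
      split_ifs at h with h'
      rw [← Option.some.inj h]
      exact h'.choose_spec
    · intro h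
      have h' : ∃ x, p x = some z := ⟨x, h⟩
      rw [dif_pos h', hp _ _ _ h'.choose_spec h]

/-- The Hilbert space `ℓ²(ι)`. -/
abbrev L2 (ι : Type w) : Type w := lp (fun _ : ι => ℂ) 2

/-- The bounded operators on `ℓ²(ι)`. -/
abbrev Op (ι : Type w) : Type w := L2 ι →L[ℂ] L2 ι

open scoped Classical in
/-- The canonical basis vector `δ_i` of `ℓ²(ι)`. -/
def δ {ι : Type w} (i : ι) : L2 ι := lp.single 2 i 1

section PEquiv

variable {ι : Type w}

lemma sum_sq_le (p : ι ≃. ι) (ξ : L2 ι) (s : Finset ι) :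
    ∑ i ∈ s, ‖(p.symm i).elim 0 ξ‖ ^ (2 : ENNReal).toReal ≤ ‖ξ‖ ^ (2 : ENNReal).toReal := by
  classical
  calc ∑ i ∈ s, ‖(p.symm i).elim 0 ξ‖ ^ (2 : ENNReal).toReal
      = ∑ i ∈ s with (p.symm i).isSome, ‖(p.symm i).elim 0 ξ‖ ^ (2 : ENNReal).toReal := by
        rw [Finset.sum_filter]
        refine Finset.sum_congr rfl fun i _ => ?_
        cases h : p.symm i <;> simp
    _ = ∑ j ∈ s.biUnion fun i => (p.symm i).toFinset, ‖ξ j‖ ^ (2 : ENNReal).toReal := by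
        symm
        rw [Finset.sum_biUnion, Finset.sum_filter]
        · refine Finset.sum_congr rfl fun i _ => ?_
          cases h : p.symm i <;> simp
        · intro i _ j _ hij
          rw [Function.onFun, Finset.disjoint_left]
          intro k hk hk'
          simp only [Option.mem_toFinset] at hk hk'
          exact hij (p.symm.inj hk hk')
    _ ≤ _ := lp.sum_rpow_le_norm_rpow (by norm_num) ξ _

/-- The partial isometry of `ℓ²(ι)` of a partial bijection `p` of `ι`: it sends `δ_i` to
`δ_{p(i)}` if `p(i)` is defined and to `0` otherwise. -/
def opOf (p : ι ≃. ι) : Op ι :=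
  LinearMap.mkContinuous
    { toFun := fun ξ => ⟨fun i => (p.symm i).elim 0 ξ, memℓp_gen' (sum_sq_le p ξ)⟩
      map_add' := fun ξ η => by
        ext i
        change (p.symm i).elim 0 (⇑ξ + ⇑η) = (p.symm i).elim 0 ⇑ξ + (p.symm i).elim 0 ⇑η
        cases h : p.symm i <;> simp
      map_smul' := fun c ξ => by
        ext i
        cases h : p.symm i <;> simp [h] }
    1 (fun ξ => by
      rw [one_mul]
      exact lp.norm_le_of_forall_sum_le (by norm_num) (norm_nonneg _) (sum_sq_le p ξ))

lemma opOf_apply (p : ι ≃. ι) (ξ : L2 ι) (i : ι) : opOf p ξ i = (p.symm i).elim 0 ξ := rfl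

lemma opOf_single (p : ι ≃. ι) (i : ι) : opOf p (δ i) = (p i).elim 0 δ := by
  classical
  ext j
  rw [opOf_apply]
  cases h : p.symm j with
  | none =>
    cases h' : p i with
    | none => rfl
    | some k =>
      simp only [Option.elim, δ, lp.single_apply]
      by_cases hk : j = k
      · subst hk
        rw [← PEquiv.eq_some_iff, h] at h'
        cases h'
      · simp [hk]
  | some l =>
    have hl := (PEquiv.eq_some_iff p).1 h
    simp only [Option.elim, δ, lp.single_apply]
    by_cases hli : l = i
    · subst hli
      simp [hl, δ]
    · cases h' : p i with
      | none => simp [hli]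
      | some k =>
        have : j ≠ k := by
          rintro rfl
          exact hli (p.inj hl h')
        simp [hli, this, δ]

lemma inner_delta (i : ι) (ξ : L2 ι) : inner ℂ (δ i) ξ = ξ i := by
  classical
  rw [δ, lp.inner_single_left]
  simp

lemma star_opOf (p : ι ≃. ι) : star (opOf p) = opOf p.symm := by
  ext ξ i
  rw [opOf_apply, PEquiv.symm_symm, ← inner_delta, ContinuousLinearMap.star_eq_adjoint,
    ContinuousLinearMap.adjoint_inner_right, opOf_single]
  cases p i with
  | none => simp
  | some j => simp [inner_delta]

lemma opOf_mul (p q : ι ≃. ι) : opOf p * opOf q = opOf (q.trans p) := by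
  ext ξ i
  rw [mul_apply_eq_comp, opOf_apply, opOf_apply, PEquiv.symm_trans_rev]
  change (p.symm i).elim 0 (opOf q ξ) = ((p.symm i).bind q.symm).elim 0 ξ
  cases p.symm i with
  | none => rfl
  | some j => exact opOf_apply q ξ j

/-- The algebra `ℓ^∞(ι)` of diagonal operators on `ℓ²(ι)`. -/
def diagonalOps (ι : Type w) : NonUnitalStarSubalgebra ℂ (Op ι) where
  carrier := {T | ∃ a : ι → ℂ, ∀ ξ i, T ξ i = a i * ξ i}
  zero_mem' := ⟨0, fun ξ i => by simp⟩
  add_mem' := by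
    rintro S T ⟨a, ha⟩ ⟨b, hb⟩
    exact ⟨a + b, fun ξ i => by simp [ha, hb, add_mul]⟩
  mul_mem' := by
    rintro S T ⟨a, ha⟩ ⟨b, hb⟩
    exact ⟨a * b, fun ξ i => by simp [ha, hb, mul_assoc]⟩
  smul_mem' := by
    rintro c T ⟨a, ha⟩
    exact ⟨c • a, fun ξ i => by simp [ha, mul_assoc]⟩
  star_mem' := by
    rintro T ⟨a, ha⟩
    refine ⟨star a, fun ξ i => ?_⟩
    have hδ : T (δ i) = a i • δ i := by
      classical
      ext j
      rw [ha, lp.coeFn_smul, Pi.smul_apply, smul_eq_mul]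
      by_cases hj : j = i
      · rw [hj]
      · simp [δ, hj]
    rw [← inner_delta, ContinuousLinearMap.star_eq_adjoint,
      ContinuousLinearMap.adjoint_inner_right, hδ, inner_smul_left, inner_delta]
    rfl

lemma diagonalOps_comm {S T : Op ι} (hS : S ∈ diagonalOps ι) (hT : T ∈ diagonalOps ι) :
    S * T = T * S := by
  obtain ⟨a, ha⟩ := hS
  obtain ⟨b, hb⟩ := hT
  ext ξ i
  simp [ha, hb, mul_left_comm]

lemma opOf_star_mul_mul_mem (p : ι ≃. ι) {T : Op ι} (hT : T ∈ diagonalOps ι) :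
    star (opOf p) * T * opOf p ∈ diagonalOps ι := by
  obtain ⟨a, ha⟩ := hT
  refine ⟨fun i => (p i).elim 0 a, fun ξ i => ?_⟩
  rw [star_opOf, mul_apply_eq_comp, mul_apply_eq_comp, opOf_apply,
    PEquiv.symm_symm]
  cases h : p i with
  | none => simp [h]
  | some j =>
    have := (PEquiv.eq_some_iff p).2 h
    simp [ha, opOf_apply, this, h]

lemma opOf_star_mul_mem (p : ι ≃. ι) : star (opOf p) * opOf p ∈ diagonalOps ι := by
  have h1 : (1 : Op ι) ∈ diagonalOps ι := ⟨1, fun ξ i => by simp⟩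
  simpa using opOf_star_mul_mul_mem p h1

lemma opOf_mul_star_mul (p : ι ≃. ι) : opOf p * star (opOf p) * opOf p = opOf p := by
  rw [star_opOf, opOf_mul, opOf_mul]
  congr 1
  ext x y
  cases h : p x with
  | none => simp [PEquiv.trans, h]
  | some j =>
    have := (PEquiv.eq_some_iff p).2 h
    simp [PEquiv.trans, h, this]

end PEquiv

/-! ### The diagonal of an operator algebra, its spectrum, and Gelfand duality -/

section Spectrum

variable {ι : Type w} (E : NonUnitalStarSubalgebra ℂ (Op ι))

/-- The commutative algebra `E ∩ ℓ^∞(ι)`. -/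
def diagPart : NonUnitalStarSubalgebra ℂ (Op ι) := E ⊓ diagonalOps ι

/-- The Gelfand spectrum of `E ∩ ℓ^∞(ι)`, with the weak-* topology. -/
abbrev Spec : Type w := WeakDual.characterSpace ℂ (diagPart E)

variable {E}

/-- The map `f ↦ V* f V` on `E ∩ ℓ^∞(ι)`, where `V ∈ E` is the operator of a partial bijection. -/
def conj (p : ι ≃. ι) (hp : opOf p ∈ E) : diagPart E →L[ℂ] diagPart E where
  toFun f := ⟨star (opOf p) * f.1 * opOf p,
    mul_mem (mul_mem (star_mem hp) f.2.1) hp, opOf_star_mul_mul_mem p f.2.2⟩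
  map_add' f g := Subtype.ext (by simp [mul_add, add_mul])
  map_smul' c f := Subtype.ext (by simp)
  cont := by
    refine Continuous.subtype_mk ?_ _
    exact (continuous_const.mul continuous_subtype_val).mul continuous_const

/-- The projection `V* V` in `E ∩ ℓ^∞(ι)`. -/
def initialProj (p : ι ≃. ι) (hp : opOf p ∈ E) : diagPart E :=
  ⟨star (opOf p) * opOf p, mul_mem (star_mem hp) hp, opOf_star_mul_mem p⟩

lemma symm_mem {p : ι ≃. ι} (hp : opOf p ∈ E) : opOf p.symm ∈ E := by
  rw [← star_opOf]
  exact star_mem hp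

lemma conj_mul (p : ι ≃. ι) (hp : opOf p ∈ E) (f g : diagPart E) :
    conj p hp (f * g) = conj p hp f * conj p hp g := by
  apply Subtype.ext
  change star (opOf p) * (f.1 * g.1) * opOf p
    = star (opOf p) * f.1 * opOf p * (star (opOf p) * g.1 * opOf p)
  have hc := diagonalOps_comm (S := opOf p * star (opOf p)) (T := g.1)
    (by
      have := opOf_star_mul_mem p.symm
      rwa [← star_opOf, star_star] at this) g.2.2
  calc star (opOf p) * (f.1 * g.1) * opOf p
      = star (opOf p) * f.1 * g.1 * (opOf p * star (opOf p) * opOf p) := by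
        rw [opOf_mul_star_mul]
        simp only [mul_assoc]
    _ = star (opOf p) * f.1 * (g.1 * (opOf p * star (opOf p))) * opOf p := by
        simp only [mul_assoc]
    _ = _ := by
        rw [← hc]
        simp only [mul_assoc]

lemma conj_symm_conj (p : ι ≃. ι) (hp : opOf p ∈ E) (f : diagPart E) :
    conj p hp (conj p.symm (symm_mem hp) f) = initialProj p hp * f * initialProj p hp := by
  apply Subtype.ext
  change star (opOf p) * (star (opOf p.symm) * f.1 * opOf p.symm) * opOf p
    = star (opOf p) * opOf p * f.1 * (star (opOf p) * opOf p)
  rw [← star_opOf, star_star]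
  simp only [mul_assoc]

lemma conj_initialProj_symm (p : ι ≃. ι) (hp : opOf p ∈ E) :
    conj p hp (initialProj p.symm (symm_mem hp)) = initialProj p hp := by
  apply Subtype.ext
  change star (opOf p) * (star (opOf p.symm) * opOf p.symm) * opOf p = star (opOf p) * opOf p
  rw [← star_opOf, star_star, mul_assoc, opOf_mul_star_mul]

lemma initialProj_mul_self (p : ι ≃. ι) (hp : opOf p ∈ E) :
    initialProj p hp * initialProj p hp = initialProj p hp := by
  apply Subtype.ext
  change star (opOf p) * opOf p * (star (opOf p) * opOf p) = star (opOf p) * opOf p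
  rw [mul_assoc, ← mul_assoc (opOf p), opOf_mul_star_mul]

lemma apply_initialProj_eq_one {p : ι ≃. ι} {hp : opOf p ∈ E} {x : Spec E}
    (hx : x (initialProj p hp) ≠ 0) : x (initialProj p hp) = 1 := by
  have h := map_mul x (initialProj p hp) (initialProj p hp)
  rw [initialProj_mul_self] at h
  exact (mul_eq_left₀ hx).1 h.symm

lemma weakDual_ne_zero {B : Type w} [AddCommMonoid B] [Module ℂ B] [TopologicalSpace B]
    {φ : WeakDual ℂ B} {b : B} (h : φ b ≠ 0) : φ ≠ 0 := by
  rintro rfl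
  exact h rfl

/-- The functional `f ↦ x(V* f V)`. -/
def pushDual (p : ι ≃. ι) (hp : opOf p ∈ E) (x : Spec E) : WeakDual ℂ (diagPart E) :=
  (WeakDual.CharacterSpace.toCLM x).comp (conj p hp)

lemma pushDual_apply (p : ι ≃. ι) (hp : opOf p ∈ E) (x : Spec E) (f : diagPart E) :
    pushDual p hp x f = x (conj p hp f) := rfl

lemma pushDual_ne_zero (p : ι ≃. ι) (hp : opOf p ∈ E) (x : Spec E)
    (hx : x (initialProj p hp) ≠ 0) : pushDual p hp x ≠ 0 := by
  refine weakDual_ne_zero (b := initialProj p.symm (symm_mem hp)) ?_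
  rwa [pushDual_apply, conj_initialProj_symm]

lemma pushDual_mul (p : ι ≃. ι) (hp : opOf p ∈ E) (x : Spec E) (f g : diagPart E) :
    pushDual p hp x (f * g) = pushDual p hp x f * pushDual p hp x g := by
  rw [pushDual_apply, pushDual_apply, pushDual_apply, conj_mul]
  exact x.2.2 _ _

/-- For a character `x` with `x(V* V) ≠ 0`, the character `f ↦ x(V* f V)`. -/
def pushChar (p : ι ≃. ι) (hp : opOf p ∈ E) (x : Spec E) (hx : x (initialProj p hp) ≠ 0) :
    Spec E :=
  ⟨pushDual p hp x, pushDual_ne_zero p hp x hx, pushDual_mul p hp x⟩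

lemma pushChar_apply (p : ι ≃. ι) (hp : opOf p ∈ E) (x : Spec E) (hx : x (initialProj p hp) ≠ 0)
    (f : diagPart E) : pushChar p hp x hx f = x (conj p hp f) := rfl

open scoped Classical in
/-- The extension of `pushChar` by the identity (an irrelevant value) to the whole spectrum. -/
def pushFun (p : ι ≃. ι) (hp : opOf p ∈ E) (x : Spec E) : Spec E :=
  if hx : x (initialProj p hp) ≠ 0 then pushChar p hp x hx else x

lemma pushFun_apply {p : ι ≃. ι} {hp : opOf p ∈ E} {x : Spec E}
    (hx : x (initialProj p hp) ≠ 0) (f : diagPart E) : pushFun p hp x f = x (conj p hp f) := by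
  rw [pushFun, dif_pos hx, pushChar_apply]

lemma pushFun_mem {p : ι ≃. ι} {hp : opOf p ∈ E} {x : Spec E}
    (hx : x (initialProj p hp) ≠ 0) :
    pushFun p hp x (initialProj p.symm (symm_mem hp)) ≠ 0 := by
  rwa [pushFun_apply hx, conj_initialProj_symm]

lemma pushFun_pushFun {p : ι ≃. ι} {hp : opOf p ∈ E} {x : Spec E}
    (hx : x (initialProj p hp) ≠ 0) : pushFun p.symm (symm_mem hp) (pushFun p hp x) = x := by
  ext f
  rw [pushFun_apply (pushFun_mem hx), pushFun_apply hx, conj_symm_conj, map_mul, map_mul,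
    apply_initialProj_eq_one hx]
  simp

lemma continuous_eval (f : diagPart E) : Continuous fun x : Spec E => x f :=
  (WeakDual.eval_continuous f).comp continuous_subtype_val

lemma isOpen_source (p : ι ≃. ι) (hp : opOf p ∈ E) :
    IsOpen {x : Spec E | x (initialProj p hp) ≠ 0} :=
  isOpen_ne_fun (continuous_eval _) continuous_const

lemma continuousOn_pushFun (p : ι ≃. ι) (hp : opOf p ∈ E) :
    ContinuousOn (pushFun p hp) {x : Spec E | x (initialProj p hp) ≠ 0} := by
  rw [continuousOn_iff_continuous_domRestrict]
  refine continuous_induced_rng.2 (WeakDual.continuous_of_continuous_eval fun f => ?_)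
  have : Continuous fun x : {x : Spec E | x (initialProj p hp) ≠ 0} => x.1 (conj p hp f) :=
    (continuous_eval _).comp continuous_subtype_val
  exact this.congr fun x => (pushFun_apply x.2 f).symm

/-- The partial homeomorphism of the spectrum of `E ∩ ℓ^∞(ι)` which corresponds by Gelfand duality
to the isomorphism `f ↦ V f V*` from the corner of `V* V` to the corner of `V V*`, where `V ∈ E` is
the operator of a partial bijection: it is defined at the characters `x` with `x(V* V) ≠ 0` and
sends such an `x` to the character `f ↦ x(V* f V)`. -/
def gelfandHomeo (p : ι ≃. ι) (hp : opOf p ∈ E) : OpenPartialHomeomorph (Spec E) (Spec E) where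
  toFun := pushFun p hp
  invFun := pushFun p.symm (symm_mem hp)
  source := {x | x (initialProj p hp) ≠ 0}
  target := {x | x (initialProj p.symm (symm_mem hp)) ≠ 0}
  map_source' _ hx := pushFun_mem hx
  map_target' _ hx := pushFun_mem hx
  left_inv' _ hx := pushFun_pushFun hx
  right_inv' _ hx := pushFun_pushFun hx
  open_source := isOpen_source p hp
  open_target := isOpen_source p.symm (symm_mem hp)
  continuousOn_toFun := continuousOn_pushFun p hp
  continuousOn_invFun := continuousOn_pushFun p.symm (symm_mem hp)

end Spectrum

/-! ### Pseudogroups and groupoids of germs -/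

section Germs

variable {X : Type w} [TopologicalSpace X]

/-- The pseudogroup generated by a set of partial homeomorphisms of `X`: the smallest set which
contains them and the identity and is closed under composition and inversion. -/
inductive Pseudogroup (A : Set (OpenPartialHomeomorph X X)) : OpenPartialHomeomorph X X → Prop
  | of (S : OpenPartialHomeomorph X X) : S ∈ A → Pseudogroup A S
  | refl : Pseudogroup A (OpenPartialHomeomorph.refl X)
  | trans (S T : OpenPartialHomeomorph X X) :
      Pseudogroup A S → Pseudogroup A T → Pseudogroup A (S.trans T)
  | symm (S : OpenPartialHomeomorph X X) : Pseudogroup A S → Pseudogroup A S.symm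

variable (A : Set (OpenPartialHomeomorph X X))

/-- The triples `(S y, S, y)` with `S` in the pseudogroup generated by `A` and `y ∈ dom S`, with the
topology of the product of the discrete pseudogroup and `X`, i.e. the disjoint union of the sets
`dom S`. -/
abbrev PreGerm : Type w := Σ S : {S : OpenPartialHomeomorph X X // Pseudogroup A S}, S.1.source

variable {A} in
/-- Two triples have the same germ if they have the same base point `y` and the two partial
homeomorphisms agree in a neighbourhood of `y`. -/
def SameGerm (a b : PreGerm A) : Prop :=
  (a.2 : X) = b.2 ∧ a.1.1 =ᶠ[nhds (a.2 : X)] b.1.1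

/-- The equivalence relation "same germ". -/
def germSetoid : Setoid (PreGerm A) where
  r := SameGerm
  iseqv :=
    { refl := fun _ => ⟨rfl, Filter.EventuallyEq.rfl⟩
      symm := fun h => ⟨h.1.symm, by rw [← h.1]; exact h.2.symm⟩
      trans := fun h h' => ⟨h.1.trans h'.1, h.2.trans (by rw [h.1]; exact h'.2)⟩ }

/-- The groupoid of germs of the pseudogroup generated by `A`, with the quotient topology
(it need not be Hausdorff). -/
def Germ : Type w := Quotient (germSetoid A)

instance : TopologicalSpace (Germ A) := inferInstanceAs (TopologicalSpace (Quotient (germSetoid A)))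

namespace Germ

variable {A}

/-- The germ `[S y, S, y]`. -/
def mk (S : OpenPartialHomeomorph X X) (hS : Pseudogroup A S) (y : X) (hy : y ∈ S.source) :
    Germ A :=
  Quotient.mk (germSetoid A) ⟨⟨S, hS⟩, ⟨y, hy⟩⟩

/-- The source of a germ: `[S y, S, y] ↦ y`. -/
def src (γ : Germ A) : X :=
  Quotient.lift (s := germSetoid A) (fun a : PreGerm A => (a.2 : X)) (fun _ _ h => h.1) γ

/-- The range of a germ: `[S y, S, y] ↦ S y`. -/
def rng (γ : Germ A) : X :=
  Quotient.lift (s := germSetoid A) (fun a : PreGerm A => a.1.1 (a.2 : X))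
    (fun a b h => by rw [← h.1]; exact h.2.self_of_nhds) γ

lemma ind {P : Germ A → Prop} (h : ∀ S hS y hy, P (mk S hS y hy)) (γ : Germ A) : P γ :=
  Quotient.inductionOn γ fun a => h a.1.1 a.1.2 a.2.1 a.2.2

lemma src_mk (S : OpenPartialHomeomorph X X) (hS : Pseudogroup A S) (y : X) (hy : y ∈ S.source) :
    (mk S hS y hy).src = y := rfl

lemma rng_mk (S : OpenPartialHomeomorph X X) (hS : Pseudogroup A S) (y : X) (hy : y ∈ S.source) :
    (mk S hS y hy).rng = S y := rfl

lemma mk_eq_mk {S T : OpenPartialHomeomorph X X} {hS : Pseudogroup A S} {hT : Pseudogroup A T}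
    {y z : X} {hy : y ∈ S.source} {hz : z ∈ T.source} :
    mk S hS y hy = mk T hT z hz ↔ y = z ∧ S =ᶠ[nhds y] T := Quotient.eq

/-- The inverse `[S y, S, y]⁻¹ = [y, S⁻¹, S y]`. -/
def inv (γ : Germ A) : Germ A :=
  Quotient.lift (s := germSetoid A) (fun a : PreGerm A =>
    mk a.1.1.symm (Pseudogroup.symm _ a.1.2) (a.1.1 a.2.1) (a.1.1.map_source a.2.2))
    (by
      rintro ⟨⟨S, hS⟩, ⟨y, hy⟩⟩ ⟨⟨T, hT⟩, ⟨z, hz⟩⟩ ⟨h₁, h₂⟩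
      change y = z at h₁
      change S =ᶠ[nhds y] T at h₂
      subst h₁
      have hST : S y = T y := h₂.self_of_nhds
      refine mk_eq_mk.2 ⟨hST, ?_⟩
      change S.symm =ᶠ[nhds (S y)] T.symm
      have hc : Filter.Tendsto S.symm (nhds (S y)) (nhds y) := by
        have := S.symm.continuousAt (S.map_source hy)
        rwa [ContinuousAt, S.left_inv hy] at this
      filter_upwards [hc.eventually h₂, hc.eventually (T.open_source.mem_nhds hz),
        S.open_target.mem_nhds (S.map_source hy)] with w hw₁ hw₂ hw₃
      rw [S.right_inv hw₃] at hw₁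
      conv_rhs => rw [hw₁]
      rw [T.left_inv hw₂]) γ

lemma rng_inv (γ : Germ A) : γ.inv.rng = γ.src := by
  induction γ using ind with
  | h S hS y hy => exact S.left_inv hy

/-- The product `[S (T y), S, T y] [T y, T, y] = [S (T y), S T, y]` of composable germs, computed
with any representatives, see `mk_mul_mk`. -/
def mul (α β : Germ A) (h : α.src = β.rng) : Germ A :=
  mk (β.out.1.1.trans α.out.1.1) (Pseudogroup.trans _ _ β.out.1.2 α.out.1.2) β.out.2.1
    (by
      rw [OpenPartialHomeomorph.trans_source]
      refine ⟨β.out.2.2, ?_⟩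
      have h₁ : α.src = α.out.2.1 := by
        conv_lhs => rw [← Quotient.out_eq α]
        rfl
      have h₂ : β.rng = β.out.1.1 β.out.2.1 := by
        conv_lhs => rw [← Quotient.out_eq β]
        rfl
      rw [Set.mem_preimage, ← h₂, ← h, h₁]
      exact α.out.2.2)

lemma mk_mul_mk (S T : OpenPartialHomeomorph X X) (hS : Pseudogroup A S) (hT : Pseudogroup A T)
    (x y : X) (hx : x ∈ S.source) (hy : y ∈ T.source) (h : x = T y)
    (hST : y ∈ (T.trans S).source) :
    mul (mk S hS x hx) (mk T hT y hy) h = mk (T.trans S) (Pseudogroup.trans _ _ hT hS) y hST := by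
  obtain ⟨h₁, h₂⟩ := Quotient.mk_out (s := germSetoid A) ⟨⟨S, hS⟩, ⟨x, hx⟩⟩
  obtain ⟨h₃, h₄⟩ := Quotient.mk_out (s := germSetoid A) ⟨⟨T, hT⟩, ⟨y, hy⟩⟩
  refine mk_eq_mk.2 ⟨h₃, ?_⟩
  change (mk S hS x hx).out.2.1 = x at h₁
  change (mk T hT y hy).out.2.1 = y at h₃
  change (mk S hS x hx).out.1.1 =ᶠ[nhds (mk S hS x hx).out.2.1] S at h₂
  change (mk T hT y hy).out.1.1 =ᶠ[nhds (mk T hT y hy).out.2.1] T at h₄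
  rw [h₁] at h₂
  rw [h₃] at h₄ ⊢
  have hc : Filter.Tendsto T (nhds y) (nhds x) := by
    rw [h]
    exact T.continuousAt hy
  filter_upwards [h₄, hc.eventually h₂] with z hz hz'
  rw [OpenPartialHomeomorph.trans_apply, OpenPartialHomeomorph.trans_apply, hz, hz']

end Germ

/-- The space `C_c(G)` of the groupoid of germs `G`, in the form needed when `G` is not Hausdorff:
the linear span of the functions which vanish outside a compact subset of some open bisection `U`
and are continuous on `U`. -/
def Cc : Submodule ℂ (Germ A → ℂ) :=
  Submodule.span ℂ {f | ∃ U : Set (Germ A), IsOpen U ∧ Set.InjOn Germ.src U ∧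
    Set.InjOn Germ.rng U ∧ ContinuousOn f U ∧
    ∃ K ⊆ U, IsCompact K ∧ ∀ γ ∉ K, f γ = 0}

variable {A}

open scoped Classical in
/-- `T` is the operator of convolution by `f` on `ℓ²(G)`, the direct sum of the spaces
`ℓ²(G_x)` for the units `x`, i.e. the direct sum of the regular representations at all units:
`(T ξ)(α) = ∑ f(α β⁻¹) ξ(β)`, the sum being over the `β` with the same source as `α`. -/
def IsRegularOp (f : Germ A → ℂ) (T : Op (Germ A)) : Prop :=
  ∀ α β : Germ A, T (δ β) α =
    if h : α.src = β.src then f (α.mul β.inv (h.trans β.rng_inv.symm)) else 0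

variable (A)

/-- The reduced C*-algebra of the groupoid of germs: the C*-algebra generated by the operators of
the regular representation of `C_c(G)`. -/
def reducedCStar : NonUnitalStarSubalgebra ℂ (Op (Germ A)) :=
  (NonUnitalStarAlgebra.adjoin ℂ {T : Op (Germ A) | ∃ f ∈ Cc A, IsRegularOp f T}).topologicalClosure

end Germs

/-! ### The two-sided Toeplitz algebra of a higher rank graph -/

namespace HigherRankGraph

variable (Λ : HigherRankGraph r V)

/-- The partial bijection `μ ↦ λ μ` of `Λ̄`. -/
def left {a b : V} (f : a ⟶ b) : Λ.Bar ≃. Λ.Bar := pequivOfInj (Λ.leftFun f) (Λ.leftFun_injective f)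

/-- The partial bijection `μ ↦ μ λ` of `Λ̄`. -/
def right {a b : V} (f : a ⟶ b) : Λ.Bar ≃. Λ.Bar :=
  pequivOfInj (Λ.rightFun f) (Λ.rightFun_injective f)

/-- The left creation operator `L_λ` on `ℓ²(Λ̄)` (a projection if `λ` is an object). -/
def L {a b : V} (f : a ⟶ b) : Op Λ.Bar := opOf (Λ.left f)

/-- The right creation operator `R_λ` on `ℓ²(Λ̄)` (a projection if `λ` is an object). -/
def R {a b : V} (f : a ⟶ b) : Op Λ.Bar := opOf (Λ.right f)

/-- The two-sided Toeplitz algebra: the C*-algebra generated by the operators `L_λ` and `R_λ` for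
the morphisms `λ` of non-zero shape (no unit is adjoined). -/
def toeplitz : NonUnitalStarSubalgebra ℂ (Op Λ.Bar) :=
  (NonUnitalStarAlgebra.adjoin ℂ
    {T : Op Λ.Bar | ∃ (a b : V) (f : a ⟶ b), Λ.shape f ≠ 0 ∧
      (T = Λ.L f ∨ T = Λ.R f)}).topologicalClosure

lemma L_mem_of_ne {a b : V} (f : a ⟶ b) (hf : Λ.shape f ≠ 0) : Λ.L f ∈ Λ.toeplitz :=
  NonUnitalStarSubalgebra.le_topologicalClosure _
    (NonUnitalStarAlgebra.subset_adjoin ℂ _ ⟨a, b, f, hf, Or.inl rfl⟩)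

lemma R_mem_of_ne {a b : V} (f : a ⟶ b) (hf : Λ.shape f ≠ 0) : Λ.R f ∈ Λ.toeplitz :=
  NonUnitalStarSubalgebra.le_topologicalClosure _
    (NonUnitalStarAlgebra.subset_adjoin ℂ _ ⟨a, b, f, hf, Or.inr rfl⟩)

lemma left_symm_trans {a b c : V} (f : a ⟶ b) (hf : Λ.shape f = 0) (g : a ⟶ c) :
    (Λ.left g).trans (Λ.left g).symm = Λ.left f := by
  classical
  rw [PEquiv.self_trans_symm]
  apply PEquiv.ext
  obtain ⟨rfl, rfl⟩ := Λ.eq_eqToHom_of_shape_eq_zero hf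
  rintro (_ | ⟨k, hk⟩)
  · have h : (Λ.left g Bar.vac).isSome := rfl
    rw [show Λ.left (eqToHom rfl) Bar.vac = some (Λ.toBar (eqToHom rfl)) from rfl,
      Λ.toBar_of_eq hf]
    simp [PEquiv.ofSet, h]
  · rename_i c d
    by_cases h : d = a
    · subst h
      have h' : (Λ.left g (Bar.mor k hk)).isSome := by
        change (Λ.leftFun g (Bar.mor k hk)).isSome
        simp [leftFun]
      have h'' : Λ.left (eqToHom (rfl : d = d)) (Bar.mor k hk) = some (Bar.mor k hk) := by
        change Λ.leftFun _ (Bar.mor k hk) = _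
        simp [leftFun, Λ.toBar_of_ne hk]
      rw [h'']
      simp [PEquiv.ofSet, h']
    · have h' : ¬ (Λ.left g (Bar.mor k hk)).isSome := by
        change ¬ (Λ.leftFun g (Bar.mor k hk)).isSome
        simp [leftFun, h]
      have h'' : Λ.left (eqToHom (rfl : a = a)) (Bar.mor k hk) = none := by
        change Λ.leftFun _ (Bar.mor k hk) = _
        simp [leftFun, h]
      rw [h'']
      simp [PEquiv.ofSet, h']

lemma right_symm_trans {a b c : V} (f : a ⟶ b) (hf : Λ.shape f = 0) (g : c ⟶ b) :
    (Λ.right g).trans (Λ.right g).symm = Λ.right f := by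
  classical
  rw [PEquiv.self_trans_symm]
  apply PEquiv.ext
  obtain ⟨rfl, rfl⟩ := Λ.eq_eqToHom_of_shape_eq_zero hf
  rintro (_ | ⟨k, hk⟩)
  · have h : (Λ.right g Bar.vac).isSome := rfl
    rw [show Λ.right (eqToHom rfl) Bar.vac = some (Λ.toBar (eqToHom rfl)) from rfl,
      Λ.toBar_of_eq hf]
    simp [PEquiv.ofSet, h]
  · rename_i d e
    by_cases h : a = d
    · subst h
      have h' : (Λ.right g (Bar.mor k hk)).isSome := by
        change (Λ.rightFun g (Bar.mor k hk)).isSome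
        simp [rightFun]
      have h'' : Λ.right (eqToHom (rfl : a = a)) (Bar.mor k hk) = some (Bar.mor k hk) := by
        change Λ.rightFun _ (Bar.mor k hk) = _
        simp [rightFun, Λ.toBar_of_ne hk]
      rw [h'']
      simp [PEquiv.ofSet, h']
    · have h' : ¬ (Λ.right g (Bar.mor k hk)).isSome := by
        change ¬ (Λ.rightFun g (Bar.mor k hk)).isSome
        simp [rightFun, h]
      have h'' : Λ.right (eqToHom (rfl : a = a)) (Bar.mor k hk) = none := by
        change Λ.rightFun _ (Bar.mor k hk) = _
        simp [rightFun, h]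
      rw [h'']
      simp [PEquiv.ofSet, h']

variable [NeZero r] [Λ.IsFinitary]

lemma one_shape_ne : (1 : Fin r → ℕ) ≠ 0 := by
  intro h
  exact one_ne_zero (congrFun h ⟨0, Nat.pos_of_ne_zero (NeZero.ne r)⟩)

lemma L_mem {a b : V} (f : a ⟶ b) : Λ.L f ∈ Λ.toeplitz := by
  by_cases hf : Λ.shape f = 0
  · obtain ⟨g, hg, rfl⟩ := IsFinitary.nonempty_from (Λ := Λ) 1 a
    have h := Λ.L_mem_of_ne g.hom (by rw [hg]; exact one_shape_ne)
    rw [L, ← Λ.left_symm_trans f hf g.hom, ← opOf_mul]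
    exact mul_mem (symm_mem h) h
  · exact Λ.L_mem_of_ne f hf

lemma R_mem {a b : V} (f : a ⟶ b) : Λ.R f ∈ Λ.toeplitz := by
  by_cases hf : Λ.shape f = 0
  · obtain ⟨g, hg, rfl⟩ := IsFinitary.nonempty_into (Λ := Λ) 1 b
    have h := Λ.R_mem_of_ne g.hom (by rw [hg]; exact one_shape_ne)
    rw [R, ← Λ.right_symm_trans f hf g.hom, ← opOf_mul]
    exact mul_mem (symm_mem h) h
  · exact Λ.R_mem_of_ne f hf

/-- The compact space `X`: the Gelfand spectrum of the diagonal of the Toeplitz algebra. -/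
abbrev X : Type (max u v) := Spec Λ.toeplitz

/-- The partial homeomorphisms `l_λ` and `r_λ` of `X` for all morphisms `λ` of `Λ`. -/
def generators : Set (OpenPartialHomeomorph Λ.X Λ.X) :=
  {S | ∃ (a b : V) (f : a ⟶ b),
    S = gelfandHomeo (Λ.left f) (Λ.L_mem f) ∨ S = gelfandHomeo (Λ.right f) (Λ.R_mem f)}

/-- The groupoid `G` of germs of the pseudogroup generated by the maps `l_λ` and `r_λ`. -/
abbrev G : Type (max u v) := Germ Λ.generators

lemma exists_diag_ne_zero (μ : Λ.Bar) : ∃ T : diagPart Λ.toeplitz, T.1 (δ μ) μ ≠ 0 := by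
  obtain ⟨p, hp, hμ⟩ : ∃ p : Λ.Bar ≃. Λ.Bar, opOf p ∈ Λ.toeplitz ∧ (p μ).isSome := by
    cases μ with
    | vac =>
      obtain ⟨g, -⟩ := IsFinitary.nonempty (Λ := Λ) 0
      exact ⟨Λ.left g.hom, Λ.L_mem _, rfl⟩
    | @mor a b f hf =>
      refine ⟨Λ.left (𝟙 b), Λ.L_mem (𝟙 b), ?_⟩
      change (Λ.leftFun _ (Bar.mor f hf)).isSome
      simp [leftFun]
  refine ⟨initialProj p hp, ?_⟩
  obtain ⟨ν, hν⟩ := Option.isSome_iff_exists.1 hμ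
  change (star (opOf p) * opOf p) (δ μ) μ ≠ 0
  rw [star_opOf, mul_apply_eq_comp, opOf_single, hν]
  rw [show (some ν).elim 0 δ = (δ ν : L2 Λ.Bar) from rfl, opOf_single,
    (PEquiv.eq_some_iff _).2 hν]
  simp [δ]

/-- The point of `X` given by `μ ∈ Λ̄`: the character sending a diagonal operator to its diagonal
entry at `μ`. -/
def point (μ : Λ.Bar) : Λ.X :=
  ⟨{ toFun := fun T => T.1 (δ μ) μ
     map_add' := fun S T => by simp
     map_smul' := fun c T => by simp
     cont := by
      have h : Continuous fun T : diagPart Λ.toeplitz => lp.evalCLM ℂ (fun _ : Λ.Bar => ℂ) 2 μ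
          (T.1 (δ μ)) := by fun_prop
      exact h }, by
    constructor
    · intro h
      obtain ⟨T, hT⟩ := Λ.exists_diag_ne_zero μ
      exact hT (DFunLike.congr_fun h T)
    · rintro ⟨S, -, a, ha⟩ ⟨T, -, b, hb⟩
      change (S * T) (δ μ) μ = S (δ μ) μ * T (δ μ) μ
      rw [mul_apply_eq_comp, ha, hb, ha]
      simp [δ]⟩

/-- The set `Λ̄` as a subset of `X`. -/
def barSet : Set Λ.X := Set.range Λ.point

/-- `π` is the canonical representation of `C*_r(G)` on `ℓ²(Λ̄)`: it restricts to the canonical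
representation of the ideal of the open invariant set `Λ̄`, in which a function `f` in `C_c(G)`
supported in the reduction of `G` to `Λ̄` acts by `f δ_μ = ∑ f(γ) δ_{r(γ)}`, the sum being over the
`γ` with source `μ`. -/
def IsCanonicalRep (π : reducedCStar Λ.generators →⋆ₙₐ[ℂ] Op Λ.Bar) : Prop :=
  ∀ f ∈ Cc Λ.generators, (∀ γ, f γ ≠ 0 → γ.src ∈ Λ.barSet ∧ γ.rng ∈ Λ.barSet) →
    ∀ T : reducedCStar Λ.generators, IsRegularOp f T.1 → ∀ μ ν : Λ.Bar,
      π T (δ μ) ν = ∑ᶠ (γ : Λ.G) (_ : γ.src = Λ.point μ ∧ γ.rng = Λ.point ν), f γ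

end HigherRankGraph

end
end TwoSidedToeplitz

namespace TwoSidedToeplitz

noncomputable section

/-! ### Matrix entries of operators on `ℓ²` -/

section Matrix

variable {ι : Type w}

/-! Compactification. By (F) there are finitely many objects, so the unit is a finite join of
projections `L_a` and lies in the Toeplitz algebra `E`. The vacuum is the only element of `Λ̄` not
of the form `g ν` with `g` of shape a unit vector; there are finitely many such `g`, so `E` contains
the projection onto `δ_Ω`, and, moving it by `L_λ`, the projection onto every `δ_μ`. Thus the
diagonal of `E` is a commutative unital C*-algebra whose spectrum `X` is compact. A character that
is nonzero on the projection onto `δ_μ` must be the point `μ`, so the points of `Λ̄` are isolated;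
they are dense because a diagonal operator with zero diagonal is zero (`dense_barSet`).

Groupoid. Every element of the pseudogroup acts on `Λ̄` by a partial bijection whose operator lies
in `E` (`exists_implements`), and `Λ̄` is invariant. Germs at isolated points are determined by
source and range, and `L_λ δ_Ω = δ_λ` connects `Ω` to every point, so `G` over `Λ̄` is the discrete
pair groupoid, with one germ `arrow μ ν` for each pair. The fibre over `Ω` is therefore a copy of
`Λ̄`, and `π` is the regular representation there: `f` has the matrix entries `f (arrow μ ν)`.

Range. A partition of unity on `X` splits `f` in `C_c(G)` into pieces of the form (operator of a
partial bijection) times (diagonal operator), all in `E` (`exists_toeplitz_of_bisection`).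
Conversely `L_λ` and `R_λ` are images of indicators of compact open bisections
(`exists_compress_eq_opOf`), and the range of a *-homomorphism is closed
(`isClosed_range_of_continuous`).

Uniqueness. The indicators of single germs `arrow μ ν` go to matrix units under any canonical
representation. Cutting `T` by two of them gives, already in `C*_r(G)`, a matrix entry of `π T`
times a third (`arrowMul_mul_mul_arrowMul`), so all matrix entries of a canonical representation are
forced. -/

lemma δ_self (i : ι) : (δ i : L2 ι) i = 1 := by
  classical
  simp [δ]

lemma δ_of_ne {i j : ι} (h : j ≠ i) : (δ i : L2 ι) j = 0 := by
  classical
  simp [δ, h]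

lemma star_apply_delta (T : Op ι) (i j : ι) : star T (δ i) j = star (T (δ j) i) := by
  rw [← inner_delta j, ContinuousLinearMap.star_eq_adjoint,
    ContinuousLinearMap.adjoint_inner_right, ← inner_delta i, ← inner_conj_symm]
  rfl

/-- A coordinate of `S ξ` is an inner product of `ξ` with the adjoint of `S` at `δ_j`, whose
coordinates are conjugates of matrix entries. No density of finite sums is needed. -/
lemma op_ext {κ : Type w} {S T : L2 ι →L[ℂ] L2 κ} (h : ∀ i j, S (δ i) j = T (δ i) j) : S = T := by
  ext ξ j
  rw [← inner_delta, ← inner_delta, ← ContinuousLinearMap.adjoint_inner_left,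
    ← ContinuousLinearMap.adjoint_inner_left]
  congr 1
  ext i
  rw [← inner_delta, ← inner_delta, ContinuousLinearMap.adjoint_inner_right,
    ContinuousLinearMap.adjoint_inner_right, ← inner_conj_symm, inner_delta, h, ← inner_delta,
    inner_conj_symm]

open scoped Classical in
lemma opOf_delta_apply (p : ι ≃. ι) (i j : ι) :
    opOf p (δ i) j = if p i = some j then 1 else 0 := by
  rw [opOf_single]
  cases h : p i with
  | none => simp
  | some k =>
    by_cases hk : k = j
    · subst hk
      simp [δ_self]
    · simp [δ_of_ne (Ne.symm hk), hk]

lemma mem_diagonalOps_apply {T : Op ι} (hT : T ∈ diagonalOps ι) (ξ : L2 ι) (i : ι) :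
    T ξ i = T (δ i) i * ξ i := by
  obtain ⟨a, ha⟩ := hT
  rw [ha, ha (δ i), δ_self, mul_one]

lemma diagonalOps_ext {S T : Op ι} (hS : S ∈ diagonalOps ι) (hT : T ∈ diagonalOps ι)
    (h : ∀ i, S (δ i) i = T (δ i) i) : S = T := by
  ext ξ i
  rw [mem_diagonalOps_apply hS, mem_diagonalOps_apply hT, h]

lemma mem_diagonalOps_iff {T : Op ι} :
    T ∈ diagonalOps ι ↔ ∀ ξ i, T ξ i = T (δ i) i * ξ i :=
  ⟨fun h => mem_diagonalOps_apply h, fun h => ⟨fun i => T (δ i) i, h⟩⟩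

lemma continuous_entry (ξ : L2 ι) (i : ι) : Continuous fun T : Op ι => T ξ i := by
  have h : Continuous fun T : Op ι => lp.evalCLM ℂ (fun _ : ι => ℂ) 2 i (T ξ) := by fun_prop
  exact h

/-- With the diagonal fixed as `T (δ i) i`, being diagonal is a family of equations between
continuous functions of `T`. -/
lemma isClosed_diagonalOps : IsClosed (diagonalOps ι : Set (Op ι)) := by
  have : (diagonalOps ι : Set (Op ι)) = ⋂ (ξ : L2 ι) (i : ι), {T | T ξ i = T (δ i) i * ξ i} := by
    ext T
    simp only [SetLike.mem_coe, mem_diagonalOps_iff, Set.mem_iInter, Set.mem_ofPred_eq]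
  rw [this]
  exact isClosed_iInter fun ξ => isClosed_iInter fun i =>
    isClosed_eq (continuous_entry ξ i) ((continuous_entry (δ i) i).mul continuous_const)

lemma one_mem_diagonalOps : (1 : Op ι) ∈ diagonalOps ι := ⟨1, fun ξ i => by simp⟩

end Matrix

/-! ### Projections onto coordinate subspaces -/

section ProjSet

variable {ι : Type w}

open scoped Classical in
/-- The projection onto the closed span of the `δ_i` with `i ∈ Z`. -/
def projSet (Z : Set ι) : Op ι := opOf (PEquiv.ofSet Z)

open scoped Classical in
lemma projSet_apply (Z : Set ι) (ξ : L2 ι) (i : ι) :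
    projSet Z ξ i = if i ∈ Z then ξ i else 0 := by
  rw [projSet, opOf_apply, PEquiv.ofSet_symm]
  by_cases h : i ∈ Z
  · simp [PEquiv.ofSet, h]
  · simp [PEquiv.ofSet, h]

lemma projSet_mem_diagonalOps (Z : Set ι) : projSet Z ∈ diagonalOps ι := by
  classical
  exact ⟨fun i => if i ∈ Z then 1 else 0, fun ξ i => by simp [projSet_apply]⟩

lemma projSet_univ : projSet (Set.univ : Set ι) = 1 := by
  ext ξ i
  simp [projSet_apply]

lemma projSet_empty : projSet (∅ : Set ι) = 0 := by
  ext ξ i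
  simp [projSet_apply]

lemma projSet_union (Y Z : Set ι) :
    projSet (Y ∪ Z) = projSet Y + projSet Z - projSet Y * projSet Z := by
  ext ξ i
  by_cases hY : i ∈ Y <;> by_cases hZ : i ∈ Z <;> simp [projSet_apply, hY, hZ]

lemma projSet_diff (Y Z : Set ι) :
    projSet (Y \ Z) = projSet Y - projSet Y * projSet Z := by
  ext ξ i
  by_cases hY : i ∈ Y <;> by_cases hZ : i ∈ Z <;> simp [projSet_apply, hY, hZ]

variable {E : NonUnitalStarSubalgebra ℂ (Op ι)}

lemma projSet_union_mem {Y Z : Set ι} (hY : projSet Y ∈ E) (hZ : projSet Z ∈ E) :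
    projSet (Y ∪ Z) ∈ E := by
  rw [projSet_union]
  exact sub_mem (add_mem hY hZ) (mul_mem hY hZ)

lemma projSet_diff_mem {Y Z : Set ι} (hY : projSet Y ∈ E) (hZ : projSet Z ∈ E) :
    projSet (Y \ Z) ∈ E := by
  rw [projSet_diff]
  exact sub_mem hY (mul_mem hY hZ)

lemma projSet_biUnion_mem {κ : Type*} {s : Set κ} (hs : s.Finite) {Z : κ → Set ι}
    (hZ : ∀ k ∈ s, projSet (Z k) ∈ E) : projSet (⋃ k ∈ s, Z k) ∈ E := by
  induction s, hs using Set.Finite.induction_on with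
  | empty =>
    simp only [Set.mem_empty_iff_false, Set.iUnion_of_empty, Set.iUnion_empty]
    rw [projSet_empty]
    exact zero_mem E
  | @insert k s _ _ ih =>
    rw [Set.biUnion_insert]
    exact projSet_union_mem (hZ k (Set.mem_insert _ _))
      (ih fun j hj => hZ j (Set.mem_insert_of_mem _ hj))

/-- With `V = opOf p` and `P = projSet Z`, the projection in question is `V P V*`. -/
lemma projSet_image_mem {p : ι ≃. ι} (hp : opOf p ∈ E) {Z : Set ι} (hZ : projSet Z ∈ E) :
    projSet {j | ∃ i ∈ Z, p i = some j} ∈ E := by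
  have : projSet {j | ∃ i ∈ Z, p i = some j} = opOf p * projSet Z * opOf p.symm := by
    classical
    rw [projSet, projSet, opOf_mul, opOf_mul]
    congr 1
    apply PEquiv.ext
    intro j
    change _ = (p.symm j).bind fun i => (PEquiv.ofSet Z i).bind p
    cases h : p.symm j with
    | none =>
      have h' : ¬ ∃ i ∈ Z, p i = some j := by
        rintro ⟨i, -, hi⟩
        rw [← PEquiv.eq_some_iff, h] at hi
        cases hi
      simp [PEquiv.ofSet, h']
    | some i =>
      have hi := (PEquiv.eq_some_iff p).1 h
      by_cases hZ : i ∈ Z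
      · have h' : ∃ i ∈ Z, p i = some j := ⟨i, hZ, hi⟩
        simp [PEquiv.ofSet, h', hZ, hi]
      · have h' : ¬ ∃ i ∈ Z, p i = some j := by
          rintro ⟨k, hk, hk'⟩
          exact hZ (p.inj hi hk' ▸ hk)
        simp [PEquiv.ofSet, h', hZ]
  rw [this]
  exact mul_mem (mul_mem hp hZ) (symm_mem hp)

lemma projSet_domain_mem {p : ι ≃. ι} (hp : opOf p ∈ E) :
    projSet {i | (p i).isSome} ∈ E := by
  classical
  have : projSet {i | (p i).isSome} = opOf p.symm * opOf p := by
    rw [opOf_mul, PEquiv.self_trans_symm, projSet]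
    congr!
  rw [this]
  exact mul_mem (symm_mem hp) hp

lemma projSet_range_mem {p : ι ≃. ι} (hp : opOf p ∈ E) :
    projSet {j | ∃ i, p i = some j} ∈ E := by
  convert projSet_domain_mem (symm_mem hp) using 2
  ext j
  simp [Option.isSome_iff_exists, PEquiv.eq_some_iff]

end ProjSet

/-! ### Gelfand duality for the diagonal -/

section Gelfand

variable {ι : Type w} {E : NonUnitalStarSubalgebra ℂ (Op ι)}

lemma isClosed_diagPart (hE : IsClosed (E : Set (Op ι))) :
    IsClosed (diagPart E : Set (Op ι)) := hE.inter isClosed_diagonalOps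

/-- The diagonal of a unital closed operator algebra as a commutative unital C*-algebra. -/
abbrev diagPartCommCStarAlgebra (hE : IsClosed (E : Set (Op ι))) (h1 : (1 : Op ι) ∈ E) :
    CommCStarAlgebra (diagPart E) :=
  haveI := isClosed_diagPart hE
  letI inst : NonUnitalCStarAlgebra (diagPart E) :=
    NonUnitalStarSubalgebra.nonUnitalCStarAlgebra (diagPart E)
  letI ring : NormedCommRing (diagPart E) :=
    { inst with
      one := ⟨1, h1, one_mem_diagonalOps⟩
      one_mul := fun a => Subtype.ext (one_mul a.1)
      mul_one := fun a => Subtype.ext (mul_one a.1)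
      mul_comm := fun a b => Subtype.ext (diagonalOps_comm a.2.2 b.2.2) }
  letI alg : NormedAlgebra ℂ (diagPart E) :=
    { Algebra.ofModule (R := ℂ) (A := diagPart E) smul_mul_assoc mul_smul_comm with
      norm_smul_le := norm_smul_le }
  { ring, inst, alg with }

lemma compactSpace_spec (hE : IsClosed (E : Set (Op ι))) (h1 : (1 : Op ι) ∈ E) :
    CompactSpace (Spec E) := by
  let := diagPartCommCStarAlgebra hE h1
  exact inferInstanceAs (CompactSpace (WeakDual.characterSpace ℂ (diagPart E)))

/-- Surjectivity of the Gelfand transform. It supplies diagonal operators with prescribed values,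
both for the density of `Λ̄` and for the coefficients of functions on bisections. -/
lemma exists_diag_of_continuous (hE : IsClosed (E : Set (Op ι))) (h1 : (1 : Op ι) ∈ E)
    (F : C(Spec E, ℂ)) : ∃ D : diagPart E, ∀ x : Spec E, x D = F x := by
  let := diagPartCommCStarAlgebra hE h1
  obtain ⟨D, hD⟩ := (gelfandTransform_bijective (diagPart E)).2 F
  exact ⟨D, fun x => DFunLike.congr_fun hD x⟩

end Gelfand

/-! ### The range of a `*`-homomorphism -/

section ClosedRange

variable {A B : Type*} [NonUnitalCStarAlgebra A] [NonUnitalCStarAlgebra B]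

/-- Truncate `a` to `[-c, c]` by functional calculus. Since `φ` commutes with the calculus and the
quasispectrum of `φ a` already lies in `[-c, c]`, the truncation does not change the image. -/
lemma exists_selfAdjoint_lift_norm_le (φ : A →⋆ₙₐ[ℂ] B) (hφ : Continuous φ) {a : A}
    (ha : IsSelfAdjoint a) {c : ℝ} (hc : ‖φ a‖ ≤ c) :
    ∃ a' : A, IsSelfAdjoint a' ∧ φ a' = φ a ∧ ‖a'‖ ≤ c := by
  have hc0 : 0 ≤ c := (norm_nonneg _).trans hc
  let f : ℝ → ℝ := fun t => max (-c) (min t c)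
  have hf : Continuous f := by fun_prop
  have hf0 : f 0 = 0 := by simp [f, hc0]
  have hφa : IsSelfAdjoint (φ a) := ha.map φ
  refine ⟨cfcₙ f a, cfcₙ_predicate f a, ?_, ?_⟩
  · rw [NonUnitalStarAlgHom.map_cfcₙ φ f a hf.continuousOn hf0 hφ ha hφa]
    conv_rhs => rw [← cfcₙ_id' ℝ (φ a)]
    refine cfcₙ_congr fun t ht => ?_
    have : ‖t‖ ≤ ‖φ a‖ :=
      NonUnitalIsometricContinuousFunctionalCalculus.norm_quasispectrum_le (φ a) ht hφa
    have := abs_le.1 (this.trans hc)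
    simp [f, this.1, this.2]
  · refine norm_cfcₙ_le fun t _ => ?_
    rw [Real.norm_eq_abs, abs_le]
    exact ⟨le_max_left _ _, max_le (by linarith) (min_le_right _ _)⟩

lemma map_realPart_of_continuous (φ : A →⋆ₙₐ[ℂ] B) (hφ : Continuous φ) (a : A) :
    φ (realPart a : A) = realPart (φ a) := by
  rw [realPart_apply_coe, realPart_apply_coe, map_real_smul φ hφ, map_add, map_star]

/-- A self-adjoint limit `b` is approximated geometrically by images of self-adjoint elements; the
differences are lifted with geometrically small norms and the lifts are summed in `A`. The general
case follows from the real parts of `b` and `i b`. -/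
lemma isClosed_range_of_continuous (φ : A →⋆ₙₐ[ℂ] B) (hφ : Continuous φ) :
    IsClosed (Set.range φ) := by
  have key : ∀ b : B, IsSelfAdjoint b → b ∈ closure (Set.range φ) → b ∈ Set.range φ := by
    intro b hb hcl
    have approx : ∀ n : ℕ, ∃ a : A, IsSelfAdjoint a ∧ ‖φ a - b‖ ≤ (1 / 2) ^ n := by
      intro n
      obtain ⟨_, ⟨a, rfl⟩, ha⟩ := Metric.mem_closure_iff.1 hcl ((1 / 2) ^ n) (by positivity)
      refine ⟨realPart a, (realPart a).2, ?_⟩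
      have h : φ (realPart a : A) - b = realPart (φ a - b) := by
        rw [map_sub, AddSubgroupClass.coe_sub, hb.coe_realPart,
          map_realPart_of_continuous φ hφ]
      rw [h]
      refine (show ‖(realPart (φ a - b) : B)‖ ≤ ‖φ a - b‖ by
        simpa using realPart.norm_le (φ a - b)).trans ?_
      rw [← dist_eq_norm, dist_comm]
      exact ha.le
    choose a ha hab using approx
    -- Both approximants are near `b`, so their difference has norm at most `(1/2)^(n+1) + (1/2)^n`,
    -- which is below `2 * (1/2)^n`.
    have step : ∀ n : ℕ, ∃ d : A, φ d = φ (a (n + 1) - a n) ∧ ‖d‖ ≤ 2 * (1 / 2) ^ n := by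
      intro n
      obtain ⟨d, -, hd, hd'⟩ := exists_selfAdjoint_lift_norm_le φ hφ ((ha (n + 1)).sub (ha n))
        (c := 2 * (1 / 2) ^ n) (by
          rw [map_sub]
          calc ‖φ (a (n + 1)) - φ (a n)‖
              = ‖(φ (a (n + 1)) - b) - (φ (a n) - b)‖ := by rw [sub_sub_sub_cancel_right]
            _ ≤ (1 / 2) ^ (n + 1) + (1 / 2) ^ n :=
              (norm_sub_le _ _).trans (add_le_add (hab _) (hab _))
            _ ≤ 2 * (1 / 2) ^ n := by
              rw [pow_succ]
              have : (0 : ℝ) ≤ (1 / 2) ^ n := by positivity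
              linarith)
      exact ⟨d, hd, hd'⟩
    choose d hd hd' using step
    have hsum : Summable d := Summable.of_norm_bounded
      ((summable_geometric_of_lt_one (by norm_num) (by norm_num : (1 / 2 : ℝ) < 1)).mul_left 2) hd'
    refine ⟨a 0 + ∑' n, d n, ?_⟩
    have h₁ : Filter.Tendsto (fun n => φ (a 0 + ∑ k ∈ Finset.range n, d k)) Filter.atTop
        (nhds (φ (a 0 + ∑' n, d n))) :=
      (hφ.tendsto _).comp (hsum.hasSum.tendsto_sum_nat.const_add (a 0))
    have h₂ : ∀ n, φ (a 0 + ∑ k ∈ Finset.range n, d k) = φ (a n) := by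
      intro n
      rw [map_add, map_sum, Finset.sum_congr rfl fun k _ => hd k, ← map_sum,
        Finset.sum_range_sub, ← map_add, add_sub_cancel]
    simp only [h₂] at h₁
    refine tendsto_nhds_unique h₁ (tendsto_iff_norm_sub_tendsto_zero.2 ?_)
    exact squeeze_zero (fun _ => norm_nonneg _) hab
      (tendsto_pow_atTop_nhds_zero_of_lt_one (by norm_num) (by norm_num))
  refine isClosed_of_closure_subset fun b hb => ?_
  have hmem : ∀ b ∈ closure (Set.range φ), (realPart b : B) ∈ Set.range φ := by
    intro b hb
    refine key _ (realPart b).2 ?_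
    refine map_mem_closure (f := fun b : B => (realPart b : B)) ?_ hb ?_
    · simp only [realPart_apply_coe]
      fun_prop
    · rintro _ ⟨a, rfl⟩
      exact ⟨realPart a, map_realPart_of_continuous φ hφ a⟩
  obtain ⟨x, hx⟩ := hmem b hb
  -- The real part of `i b` is minus the imaginary part of `b`, which explains the sign in the
  -- preimage `x - i y`.
  obtain ⟨y, hy⟩ := hmem (Complex.I • b) (map_mem_closure (continuous_const_smul _) hb (by
    rintro _ ⟨a, rfl⟩
    exact ⟨Complex.I • a, map_smul _ _ _⟩))
  refine ⟨x - Complex.I • y, ?_⟩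
  rw [map_sub, map_smul, hx, hy, realPart_I_smul]
  conv_rhs => rw [← realPart_add_I_smul_imaginaryPart b]
  simp [sub_eq_add_neg]

end ClosedRange

namespace HigherRankGraph

variable {r : ℕ} {V : Type u} [Category.{v} V] (Λ : HigherRankGraph r V)

/-! ### Diagonal projections in the Toeplitz algebra -/

lemma left_toBar {a b c : V} (f : b ⟶ c) (g : a ⟶ b) :
    Λ.left f (Λ.toBar g) = some (Λ.toBar (g ≫ f)) := by
  by_cases hg : Λ.shape g = 0
  · obtain ⟨rfl, rfl⟩ := Λ.eq_eqToHom_of_shape_eq_zero hg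
    rw [Λ.toBar_of_eq hg]
    simp only [eqToHom_refl, Category.id_comp]
    rfl
  · rw [Λ.toBar_of_ne hg]
    change Λ.leftFun f (Bar.mor g hg) = _
    simp [leftFun]

/-- Some coordinate `i` of the shape is positive, so unique factorization splits off a left factor
of shape `e_i`. The other factor may be an object, in which case `μ` is `Ω`. -/
lemma exists_left_eq_of_shape_ne_zero {a b : V} (f : a ⟶ b) (hf : Λ.shape f ≠ 0) :
    ∃ (i : Fin r) (g : Arrow V), Λ.shape g.hom = Pi.single i 1 ∧
      ∃ μ, Λ.left g.hom μ = some (Bar.mor f hf) := by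
  obtain ⟨i, hi⟩ := Function.ne_iff.1 hf
  obtain ⟨⟨c, g, h⟩, ⟨hg, -, hgh⟩, -⟩ := Λ.factorization f (Pi.single i 1)
    (Λ.shape f - Pi.single i 1) (by
      ext j
      by_cases hj : j = i
      · subst hj
        have : 1 ≤ Λ.shape f j := Nat.one_le_iff_ne_zero.2 hi
        simp only [Pi.add_apply, Pi.sub_apply, Pi.single_eq_same]
        omega
      · simp [hj])
  refine ⟨i, Arrow.mk g, hg, Λ.toBar h, ?_⟩
  dsimp only at hgh
  subst hgh
  rw [← Λ.toBar_of_ne hf]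
  exact Λ.left_toBar g h

lemma isClosed_toeplitz : IsClosed (Λ.toeplitz : Set (Op Λ.Bar)) :=
  NonUnitalStarSubalgebra.isClosed_topologicalClosure _

/-- The identities are distinct morphisms of shape zero, and (F) bounds their number. -/
lemma finite_objects (Λ : HigherRankGraph r V) [Λ.IsFinitary] : Finite V := by
  have := (IsFinitary.finite (Λ := Λ) 0).to_subtype
  refine Finite.of_injective
    (fun a : V => (⟨Arrow.mk (𝟙 a), Λ.shape_id a⟩ : {f : Arrow V | Λ.shape f.hom = 0})) ?_
  intro a b hab
  exact congrArg Comma.left (Subtype.mk.inj hab)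

variable [NeZero r] [Λ.IsFinitary]

/-- Every morphism ends at some object, and `Ω` lies in the domain of every `L_a`, so finitely many
projections `L_a` cover everything. This makes `E` unital. -/
lemma projSet_univ_mem_toeplitz : projSet (Set.univ : Set Λ.Bar) ∈ Λ.toeplitz := by
  have := Λ.finite_objects
  have h : (Set.univ : Set Λ.Bar) =
      ⋃ a ∈ (Set.univ : Set V), {μ | (Λ.left (𝟙 a) μ).isSome} := by
    symm
    rw [Set.eq_univ_iff_forall]
    intro μ
    simp only [Set.mem_univ, Set.iUnion_true, Set.mem_iUnion]
    cases μ with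
    | vac =>
      obtain ⟨g, -⟩ := IsFinitary.nonempty (Λ := Λ) 0
      exact ⟨g.left, rfl⟩
    | @mor a b f hf =>
      refine ⟨b, ?_⟩
      change (Λ.leftFun _ (Bar.mor f hf)).isSome
      simp [leftFun]
  rw [h]
  exact projSet_biUnion_mem Set.finite_univ fun a _ => projSet_domain_mem (Λ.L_mem (𝟙 a))

lemma one_mem_toeplitz : (1 : Op Λ.Bar) ∈ Λ.toeplitz := by
  rw [← projSet_univ]
  exact Λ.projSet_univ_mem_toeplitz

/-- An element of `Λ̄` other than `Ω` begins with a factor of shape some `e_i`, and `Ω` does not.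
There are finitely many such factors `g`, so removing the range projections of the `L_g` from the
unit leaves the projection onto `δ_Ω`. -/
lemma projSet_vac_mem_toeplitz : projSet ({Bar.vac} : Set Λ.Bar) ∈ Λ.toeplitz := by
  have h : ({Bar.vac} : Set Λ.Bar) = Set.univ \
      ⋃ g ∈ ⋃ i : Fin r, {g : Arrow V | Λ.shape g.hom = Pi.single i 1},
        {μ | ∃ ν, Λ.left g.hom ν = some μ} := by
    ext μ
    simp only [Set.mem_singleton_iff, Set.mem_sdiff, Set.mem_univ, true_and, Set.mem_iUnion,
      Set.mem_ofPred_eq, exists_prop, not_exists, not_and]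
    constructor
    · rintro rfl g ⟨i, hi⟩ ν hν
      have hg : Λ.shape g.hom ≠ 0 := by
        rw [hi]
        intro h
        simpa using congrFun h i
      change Λ.leftFun g.hom ν = _ at hν
      cases ν with
      | vac =>
        simp only [leftFun, Λ.toBar_of_ne hg] at hν
        cases hν
      | @mor a b k hk =>
        simp only [leftFun] at hν
        split_ifs at hν with hb
        subst hb
        rw [Λ.toBar_of_ne] at hν
        · cases hν
        · simp only [eqToHom_refl, Category.id_comp]
          exact Λ.shape_comp_ne (Or.inl hg)
    · intro hμ
      cases μ with
      | vac => rfl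
      | mor f hf =>
        obtain ⟨i, g, hg, ν, hν⟩ := Λ.exists_left_eq_of_shape_ne_zero f hf
        exact absurd hν (hμ g ⟨i, hg⟩ ν)
  rw [h]
  exact projSet_diff_mem Λ.projSet_univ_mem_toeplitz
    (projSet_biUnion_mem (Set.finite_iUnion fun i => IsFinitary.finite _)
      fun g _ => projSet_range_mem (Λ.L_mem g.hom))

lemma projSet_singleton_mem_toeplitz (μ : Λ.Bar) : projSet {μ} ∈ Λ.toeplitz := by
  cases μ with
  | vac => exact Λ.projSet_vac_mem_toeplitz
  | mor f hf =>
    convert projSet_image_mem (Λ.L_mem f) Λ.projSet_vac_mem_toeplitz using 2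
    ext ν
    have h : Λ.left f Bar.vac = some (Bar.mor f hf) := by
      rw [← Λ.toBar_of_ne hf]
      rfl
    simp [h, eq_comm]

/-! ### The spectrum of the diagonal as a compactification -/

lemma point_apply (μ : Λ.Bar) (T : diagPart Λ.toeplitz) : Λ.point μ T = T.1 (δ μ) μ := rfl

/-- The projection onto the line of `δ_μ`, in the diagonal of the Toeplitz algebra. -/
def atom (μ : Λ.Bar) : diagPart Λ.toeplitz :=
  ⟨projSet {μ}, Λ.projSet_singleton_mem_toeplitz μ, projSet_mem_diagonalOps _⟩

lemma point_atom_self (μ : Λ.Bar) : Λ.point μ (Λ.atom μ) = 1 := by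
  rw [point_apply, atom, projSet_apply]
  simp [δ_self]

lemma point_atom_of_ne {μ ν : Λ.Bar} (h : ν ≠ μ) : Λ.point ν (Λ.atom μ) = 0 := by
  rw [point_apply, atom, projSet_apply]
  simp [h]

lemma point_injective : Function.Injective Λ.point := by
  intro μ ν h
  by_contra hne
  have h₁ := Λ.point_atom_self μ
  rw [h, Λ.point_atom_of_ne (Ne.symm hne)] at h₁
  exact zero_ne_one h₁

lemma mul_atom (μ : Λ.Bar) (T : diagPart Λ.toeplitz) :
    T * Λ.atom μ = Λ.point μ T • Λ.atom μ := by
  apply Subtype.ext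
  change T.1 * projSet {μ} = T.1 (δ μ) μ • projSet {μ}
  ext ξ i
  rw [mul_apply_eq_comp, mem_diagonalOps_apply T.2.2]
  by_cases h : i = μ
  · subst h
    simp [projSet_apply]
  · simp [projSet_apply, h]

/-- `T * atom μ` is the scalar `T_μμ` times `atom μ`; apply `x` and cancel `x (atom μ)`. -/
lemma eq_point_of_apply_atom_ne_zero {x : Λ.X} {μ : Λ.Bar} (hx : x (Λ.atom μ) ≠ 0) :
    x = Λ.point μ := by
  ext T
  have h := map_mul x T (Λ.atom μ)
  rw [mul_atom, map_smul, smul_eq_mul] at h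
  exact (mul_right_cancel₀ hx h).symm

lemma isOpen_singleton_point (μ : Λ.Bar) : IsOpen {Λ.point μ} := by
  have h : {Λ.point μ} = {x : Λ.X | x (Λ.atom μ) ≠ 0} := by
    ext x
    refine ⟨?_, fun hx => Λ.eq_point_of_apply_atom_ne_zero hx⟩
    rintro rfl
    simp [point_atom_self]
  rw [h]
  exact isOpen_ne_fun (continuous_eval _) continuous_const

lemma nhds_point (μ : Λ.Bar) : nhds (Λ.point μ) = pure (Λ.point μ) :=
  (isOpen_singleton_iff_nhds_eq_pure _).1 (Λ.isOpen_singleton_point μ)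

lemma isOpen_barSet : IsOpen Λ.barSet := by
  have : Λ.barSet = ⋃ μ, {Λ.point μ} := (Set.iUnion_singleton_eq_range _).symm
  rw [this]
  exact isOpen_iUnion Λ.isOpen_singleton_point

lemma discreteTopology_barSet : DiscreteTopology Λ.barSet := by
  rw [discreteTopology_iff_isOpen_singleton]
  rintro ⟨_, μ, rfl⟩
  convert (Λ.isOpen_singleton_point μ).preimage continuous_subtype_val
  ext x
  simp [Subtype.ext_iff]

instance compactSpace_X : CompactSpace Λ.X :=
  compactSpace_spec Λ.isClosed_toeplitz Λ.one_mem_toeplitz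

/-- A continuous function vanishing on the closure of `Λ̄` but not at `x` would be, by Gelfand
duality, a diagonal operator all of whose diagonal entries vanish, hence zero. -/
lemma dense_barSet : Dense Λ.barSet := by
  rw [dense_iff_closure_eq, Set.eq_univ_iff_forall]
  by_contra! h
  obtain ⟨x, hx⟩ := h
  obtain ⟨F, hF₀, hF₁, -⟩ := exists_continuous_zero_one_of_isClosed (isClosed_closure)
    (isClosed_singleton (x := x)) (Set.disjoint_singleton_right.2 hx)
  obtain ⟨D, hD⟩ := exists_diag_of_continuous Λ.isClosed_toeplitz Λ.one_mem_toeplitz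
    (⟨fun y => (F y : ℂ), by fun_prop⟩ : C(Λ.X, ℂ))
  have hD0 : D = 0 := by
    apply Subtype.ext
    refine diagonalOps_ext D.2.2 (zero_mem _) fun μ => ?_
    have h := hD (Λ.point μ)
    rw [point_apply] at h
    rw [h]
    have := hF₀ (subset_closure (Set.mem_range_self μ : Λ.point μ ∈ Λ.barSet))
    simp [this]
  have h := hD x
  have := hF₁ rfl
  rw [hD0, map_zero] at h
  simp [this] at h

end HigherRankGraph

/-! ### The groupoid of germs -/

section Germs

variable {X : Type w} [TopologicalSpace X] {A : Set (OpenPartialHomeomorph X X)}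

namespace Germ

lemma continuous_mk (S : OpenPartialHomeomorph X X) (hS : Pseudogroup A S) :
    Continuous fun x : S.source => mk S hS x.1 x.2 := by
  have h : Continuous fun x : S.source => (⟨⟨S, hS⟩, x⟩ : PreGerm A) :=
    continuous_sigmaMk (σ := fun S : {S : OpenPartialHomeomorph X X // Pseudogroup A S} =>
      (S.1.source : Type w)) (i := ⟨S, hS⟩)
  exact continuous_quot_mk.comp h

lemma continuous_src : Continuous (src : Germ A → X) := by
  refine Continuous.quotient_lift (s := germSetoid A) ?_ _
  exact continuous_sigma fun S => continuous_subtype_val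

/-- The germs of a partial homeomorphism of the pseudogroup at all points of its domain. -/
def bisection (S : OpenPartialHomeomorph X X) (hS : Pseudogroup A S) : Set (Germ A) :=
  Set.range fun x : S.source => mk S hS x.1 x.2

/-- In the disjoint union of the domains, the preimage meets `dom T` in the points of `dom S` near
which `T` and `S` agree, and local agreement is an open condition. -/
lemma isOpen_bisection (S : OpenPartialHomeomorph X X) (hS : Pseudogroup A S) :
    IsOpen (bisection S hS) := by
  refine isQuotientMap_quot_mk.isOpen_preimage.1 ?_
  rw [isOpen_sigma_iff]
  rintro ⟨T, hT⟩
  have h : IsOpen ({z : X | T =ᶠ[nhds z] S} ∩ S.source) :=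
    isOpen_setOfPred_eventually_nhds.inter S.open_source
  convert h.preimage (continuous_subtype_val (p := (· ∈ T.source)))
  ext z
  constructor
  · rintro ⟨x, hx⟩
    obtain ⟨h₁, h₂⟩ := mk_eq_mk.1 (show mk S hS x.1 x.2 = mk T hT z.1 z.2 from hx)
    refine ⟨?_, h₁ ▸ x.2⟩
    change T =ᶠ[nhds z.1] S
    rw [← h₁]
    exact h₂.symm
  · rintro ⟨h₁, h₂⟩
    exact ⟨⟨z.1, h₂⟩, mk_eq_mk.2 ⟨rfl, h₁.symm⟩⟩

lemma injOn_src_bisection (S : OpenPartialHomeomorph X X) (hS : Pseudogroup A S) :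
    Set.InjOn src (bisection S hS) := by
  rintro _ ⟨x, rfl⟩ _ ⟨y, rfl⟩ h
  have h' : x.1 = y.1 := h
  rw [Subtype.ext h']

lemma injOn_rng_bisection (S : OpenPartialHomeomorph X X) (hS : Pseudogroup A S) :
    Set.InjOn rng (bisection S hS) := by
  rintro _ ⟨x, rfl⟩ _ ⟨y, rfl⟩ h
  have h' : x.1 = y.1 := S.injOn x.2 y.2 h
  rw [Subtype.ext h']

lemma isCompact_bisection [CompactSpace X] (S : OpenPartialHomeomorph X X)
    (hS : Pseudogroup A S) (h : IsClosed S.source) : IsCompact (bisection S hS) := by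
  have := isCompact_iff_compactSpace.1 h.isCompact
  exact isCompact_range (continuous_mk S hS)

lemma src_inv (γ : Germ A) : γ.inv.src = γ.rng := by
  induction γ using ind with
  | h S hS y hy => rfl

/-- Aligned representatives turn products of germs into compositions of partial homeomorphisms. -/
lemma exists_mul_eq_mk (α β : Germ A) (h : α.src = β.rng) :
    ∃ (S T : OpenPartialHomeomorph X X) (hS : Pseudogroup A S) (hT : Pseudogroup A T) (y : X)
      (hy : y ∈ T.source) (hTy : T y ∈ S.source) (hST : y ∈ (T.trans S).source),
      α = mk S hS (T y) hTy ∧ β = mk T hT y hy ∧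
      mul α β h = mk (T.trans S) (Pseudogroup.trans _ _ hT hS) y hST := by
  induction α using ind with
  | h S hS x hx =>
    induction β using ind with
    | h T hT y hy =>
      have h' : x = T y := h
      subst h'
      have hST : y ∈ (T.trans S).source := by
        rw [OpenPartialHomeomorph.trans_source]
        exact ⟨hy, hx⟩
      exact ⟨S, T, hS, hT, y, hy, hx, hST, rfl, rfl, mk_mul_mk _ _ _ _ _ _ _ _ _ _⟩

lemma src_mul (α β : Germ A) (h : α.src = β.rng) : (mul α β h).src = β.src := by
  obtain ⟨S, T, hS, hT, y, hy, hTy, hST, -, hβ, e⟩ := exists_mul_eq_mk α β h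
  rw [e, hβ]
  rfl

lemma rng_mul (α β : Germ A) (h : α.src = β.rng) : (mul α β h).rng = α.rng := by
  obtain ⟨S, T, hS, hT, y, hy, hTy, hST, hα, -, e⟩ := exists_mul_eq_mk α β h
  rw [e, hα]
  rfl

lemma mul_congr {α α' β β' : Germ A} (hα : α = α') (hβ : β = β') (h : α.src = β.rng)
    (h' : α'.src = β'.rng) : mul α β h = mul α' β' h' := by
  subst hα hβ
  rfl

lemma mul_mul_inv (γ β : Germ A) (h : γ.src = β.rng)
    (h' : (mul γ β h).src = β.inv.rng) : mul (mul γ β h) β.inv h' = γ := by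
  obtain ⟨S, T, hS, hT, y, hy, hTy, hST, hγ, hβ, e⟩ := exists_mul_eq_mk γ β h
  have hi : β.inv = mk T.symm (Pseudogroup.symm _ hT) (T y) (T.map_source hy) := by
    rw [hβ]
    rfl
  have hy' : y = T.symm (T y) := (T.left_inv hy).symm
  have hs : T y ∈ (T.symm.trans (T.trans S)).source := by
    rw [OpenPartialHomeomorph.trans_source]
    refine ⟨T.map_source hy, ?_⟩
    rw [Set.mem_preimage, ← hy']
    exact hST
  refine (mul_congr e hi h' hy').trans ((mk_mul_mk _ _ _ _ _ _ _ _ _ hs).trans ?_)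
  rw [hγ, mk_eq_mk]
  refine ⟨rfl, ?_⟩
  filter_upwards [T.open_target.mem_nhds (T.map_source hy)] with z hz
  simp [T.right_inv hz]

lemma mul_inv_mul (α β : Germ A) (h : α.src = β.inv.rng)
    (h' : (mul α β.inv h).src = β.rng) : mul (mul α β.inv h) β h' = α := by
  obtain ⟨T, hT, y, hy, rfl⟩ : ∃ T hT y hy, β = mk T hT y hy := by
    induction β using ind with
    | h T hT y hy => exact ⟨T, hT, y, hy, rfl⟩
  obtain ⟨S, hS, x, hx, rfl⟩ : ∃ T hT y hy, α = mk T hT y hy := by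
    induction α using ind with
    | h T hT y hy => exact ⟨T, hT, y, hy, rfl⟩
  have hxy : x = y := h.trans (rng_inv _)
  subst hxy
  have hs : T x ∈ (T.symm.trans S).source := by
    rw [OpenPartialHomeomorph.trans_source]
    refine ⟨T.map_source hy, ?_⟩
    rw [Set.mem_preimage, T.left_inv hy]
    exact hx
  have e : mul (mk S hS x hx) (mk T hT x hy).inv h = mk (T.symm.trans S) _ (T x) hs :=
    mk_mul_mk S T.symm hS (Pseudogroup.symm _ hT) x (T x) hx (T.map_source hy) h hs
  have hs' : x ∈ (T.trans (T.symm.trans S)).source := by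
    rw [OpenPartialHomeomorph.trans_source]
    exact ⟨hy, hs⟩
  refine (mul_congr e rfl h' rfl).trans ((mk_mul_mk _ _ _ _ _ _ _ _ _ hs').trans ?_)
  rw [mk_eq_mk]
  refine ⟨rfl, ?_⟩
  filter_upwards [T.open_source.mem_nhds hy] with z hz
  simp [T.left_inv hz]

/-- Near the base point both factors map into the domain of a representative of `γ`, which is
injective there. -/
lemma mul_left_cancel_germ {γ β β' : Germ A} {h : γ.src = β.rng} {h' : γ.src = β'.rng}
    (e : mul γ β h = mul γ β' h') : β = β' := by
  obtain ⟨T, hT, y, hy, rfl⟩ : ∃ T hT y hy, β = mk T hT y hy := by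
    induction β using ind with
    | h T hT y hy => exact ⟨T, hT, y, hy, rfl⟩
  obtain ⟨T', hT', y', hy', rfl⟩ : ∃ T hT y hy, β' = mk T hT y hy := by
    induction β' using ind with
    | h T hT y hy => exact ⟨T, hT, y, hy, rfl⟩
  induction γ using ind with
  | h S hS x hx =>
    have h₁ : x = T y := h
    have h₁' : x = T' y' := h'
    have hs : y ∈ (T.trans S).source := by
      rw [OpenPartialHomeomorph.trans_source]
      exact ⟨hy, by rwa [Set.mem_preimage, ← h₁]⟩
    have hs' : y' ∈ (T'.trans S).source := by
      rw [OpenPartialHomeomorph.trans_source]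
      exact ⟨hy', by rwa [Set.mem_preimage, ← h₁']⟩
    obtain ⟨rfl, he⟩ := mk_eq_mk.1 ((mk_mul_mk _ _ _ _ _ _ _ _ h₁ hs).symm.trans
      (e.trans (mk_mul_mk _ _ _ _ _ _ _ _ h₁' hs')))
    refine mk_eq_mk.2 ⟨rfl, ?_⟩
    have hn : ∀ᶠ z in nhds y, T z ∈ S.source :=
      (T.continuousAt hy).eventually (S.open_source.mem_nhds (h₁ ▸ hx))
    have hn' : ∀ᶠ z in nhds y, T' z ∈ S.source :=
      (T'.continuousAt hy').eventually (S.open_source.mem_nhds (h₁' ▸ hx))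
    filter_upwards [he, hn, hn'] with z hz h₂ h₂'
    exact S.injOn h₂ h₂' hz

/-! ### The operators of bisections -/

open scoped Classical in
/-- Left multiplication by a set of germs on which the source map is injective. -/
def leftMulFun (U : Set (Germ A)) (β : Germ A) : Option (Germ A) :=
  if h : ∃ γ ∈ U, γ.src = β.rng then some (mul h.choose β h.choose_spec.2) else none

lemma leftMulFun_eq_some {U : Set (Germ A)} (hU : Set.InjOn src U) {α β : Germ A} :
    leftMulFun U β = some α ↔ ∃ γ ∈ U, ∃ h : γ.src = β.rng, mul γ β h = α := by
  rw [leftMulFun]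
  constructor
  · intro h
    split_ifs at h with h'
    exact ⟨_, h'.choose_spec.1, h'.choose_spec.2, Option.some.inj h⟩
  · rintro ⟨γ, hγ, h, rfl⟩
    have h' : ∃ γ ∈ U, γ.src = β.rng := ⟨γ, hγ, h⟩
    rw [dif_pos h']
    congr 1
    exact mul_congr (hU h'.choose_spec.1 hγ (h'.choose_spec.2.trans h.symm)) rfl _ _

/-- Left multiplication by an open bisection, as a partial bijection of the groupoid. -/
def leftMul (U : Set (Germ A)) (hs : Set.InjOn src U) (hr : Set.InjOn rng U) :
    Germ A ≃. Germ A :=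
  pequivOfInj (leftMulFun U) (by
    intro β β' α h h'
    obtain ⟨γ, hγ, hc, e⟩ := (leftMulFun_eq_some hs).1 h
    obtain ⟨γ', hγ', hc', e'⟩ := (leftMulFun_eq_some hs).1 h'
    have : γ = γ' := by
      refine hr hγ hγ' ?_
      rw [← rng_mul γ β hc, e, ← e', rng_mul]
    subst this
    exact mul_left_cancel_germ (e.trans e'.symm))

lemma leftMul_eq_some {U : Set (Germ A)} (hs : Set.InjOn src U) (hr : Set.InjOn rng U)
    {α β : Germ A} :
    leftMul U hs hr β = some α ↔ ∃ γ ∈ U, ∃ h : γ.src = β.rng, mul γ β h = α :=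
  leftMulFun_eq_some hs

/-- For germs with a common source, `α = γ β` means `γ = α β⁻¹`, so the entry is 1 exactly when `α
β⁻¹ ∈ U`. Left multiplication preserves sources, so all other entries vanish. -/
lemma isRegularOp_indicator {U : Set (Germ A)} (hs : Set.InjOn src U) (hr : Set.InjOn rng U) :
    IsRegularOp (U.indicator 1) (opOf (leftMul U hs hr)) := by
  classical
  intro α β
  simp only [opOf_delta_apply, leftMul_eq_some]
  by_cases h : α.src = β.src
  · rw [dif_pos h, Set.indicator_apply]
    congr 1
    rw [eq_iff_iff]
    constructor
    · rintro ⟨γ, hγ, hc, rfl⟩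
      rwa [mul_mul_inv]
    · intro hm
      exact ⟨_, hm, (src_mul _ _ _).trans (src_inv β), mul_inv_mul _ _ _ _⟩
  · rw [dif_neg h, if_neg]
    rintro ⟨γ, -, hc, rfl⟩
    exact h (src_mul _ _ _)

/-- A compact `U` need not be closed in a non-Hausdorff groupoid, but continuity is required on `U`
only, and `K = U` serves as the support. -/
lemma indicator_mem_Cc {U : Set (Germ A)} (ho : IsOpen U) (hs : Set.InjOn src U)
    (hr : Set.InjOn rng U) (hc : IsCompact U) : U.indicator 1 ∈ Cc A := by
  refine Submodule.subset_span ⟨U, ho, hs, hr, ?_, U, subset_rfl, hc, fun γ hγ => ?_⟩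
  · exact (continuousOn_const (c := (1 : ℂ))).congr fun γ hγ => Set.indicator_of_mem hγ 1
  · exact Set.indicator_of_notMem hγ 1

lemma mem_reducedCStar {f : Germ A → ℂ} (hf : f ∈ Cc A) {T : Op (Germ A)}
    (hT : IsRegularOp f T) : T ∈ reducedCStar A :=
  NonUnitalStarSubalgebra.le_topologicalClosure _
    (NonUnitalStarAlgebra.subset_adjoin ℂ _ ⟨f, hf, hT⟩)

end Germ

end Germs

/-! ### Basis vectors under diagonal operators, and the points where a germ lies in a given set -/

lemma opOf_refl {ι : Type w} : opOf (PEquiv.refl ι) = 1 := by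
  ext ξ i
  rfl

lemma diag_apply_delta {ι : Type w} {D : Op ι} (hD : D ∈ diagonalOps ι) (i : ι) :
    D (δ i) = D (δ i) i • δ i := by
  ext j
  by_cases h : j = i
  · subst h
    simp [δ_self]
  · rw [mem_diagonalOps_apply hD]
    simp [δ_of_ne h]

/-- The points at which `[S, x]` is defined and lies in `U`. -/
def Germ.domainIn {X : Type w} [TopologicalSpace X] {A : Set (OpenPartialHomeomorph X X)}
    (S : OpenPartialHomeomorph X X) (hS : Pseudogroup A S) (U : Set (Germ A)) : Set X :=
  Subtype.val '' {x : S.source | Germ.mk S hS x.1 x.2 ∈ U}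

lemma Germ.isOpen_domainIn {X : Type w} [TopologicalSpace X]
    {A : Set (OpenPartialHomeomorph X X)} (S : OpenPartialHomeomorph X X)
    (hS : Pseudogroup A S) {U : Set (Germ A)} (hU : IsOpen U) : IsOpen (Germ.domainIn S hS U) :=
  S.open_source.isOpenMap_subtype_val _ (hU.preimage (Germ.continuous_mk S hS))

namespace HigherRankGraph

variable {r : ℕ} {V : Type u} [Category.{v} V] (Λ : HigherRankGraph r V)
variable [NeZero r] [Λ.IsFinitary]

/-! ### The pseudogroup on the points of `Λ̄` -/

lemma point_initialProj_ne_zero_iff (p : Λ.Bar ≃. Λ.Bar) (hp : opOf p ∈ Λ.toeplitz) (μ : Λ.Bar) :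
    Λ.point μ (initialProj p hp) ≠ 0 ↔ ∃ ν, p μ = some ν := by
  classical
  rw [point_apply]
  change (star (opOf p) * opOf p) (δ μ) μ ≠ 0 ↔ _
  rw [star_opOf, opOf_mul, opOf_delta_apply]
  change (if (p μ).bind p.symm = some μ then (1 : ℂ) else 0) ≠ 0 ↔ _
  cases h : p μ with
  | none => simp
  | some ν => simp [(PEquiv.eq_some_iff p).2 h]

lemma gelfandHomeo_point (p : Λ.Bar ≃. Λ.Bar) (hp : opOf p ∈ Λ.toeplitz) {μ ν : Λ.Bar}
    (h : p μ = some ν) : gelfandHomeo p hp (Λ.point μ) = Λ.point ν := by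
  ext T
  refine (pushFun_apply ((Λ.point_initialProj_ne_zero_iff p hp μ).2 ⟨ν, h⟩) T).trans ?_
  rw [point_apply, point_apply]
  change (star (opOf p) * T.1 * opOf p) (δ μ) μ = _
  rw [mul_apply_eq_comp, mul_apply_eq_comp, star_opOf, opOf_apply, PEquiv.symm_symm, h,
    opOf_single, h]
  rfl

/-- The partial bijection `q` of `Λ̄` describes `S` on the points of `Λ̄`. -/
def Implements (S : OpenPartialHomeomorph Λ.X Λ.X) (q : Λ.Bar ≃. Λ.Bar) : Prop :=
  ∀ μ, (Λ.point μ ∈ S.source → ∃ ν, q μ = some ν) ∧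
    ∀ ν, q μ = some ν → Λ.point μ ∈ S.source ∧ S (Λ.point μ) = Λ.point ν

lemma implements_gelfandHomeo (p : Λ.Bar ≃. Λ.Bar) (hp : opOf p ∈ Λ.toeplitz) :
    Λ.Implements (gelfandHomeo p hp) p := fun μ =>
  ⟨(Λ.point_initialProj_ne_zero_iff p hp μ).1, fun ν h =>
    ⟨(Λ.point_initialProj_ne_zero_iff p hp μ).2 ⟨ν, h⟩, Λ.gelfandHomeo_point p hp h⟩⟩

/-- The preimage under `S` of an isolated point is open and non-empty, so it meets the dense set
`Λ̄`; by injectivity it consists of `x` alone. -/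
lemma mem_barSet_of_apply_mem {S : OpenPartialHomeomorph Λ.X Λ.X} {x : Λ.X} (hx : x ∈ S.source)
    (h : S x ∈ Λ.barSet) : x ∈ Λ.barSet := by
  obtain ⟨μ, hμ⟩ := h
  have ho : IsOpen (S.source ∩ S ⁻¹' {Λ.point μ}) :=
    S.isOpen_inter_preimage (Λ.isOpen_singleton_point μ)
  obtain ⟨y, ⟨hy, hy'⟩, hb⟩ := Λ.dense_barSet.inter_open_nonempty _ ho ⟨x, hx, hμ.symm⟩
  rwa [S.injOn hx hy (hμ.symm.trans hy'.symm)]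

/-- Compositions and inverses correspond to products and adjoints of operators, which stay in `E`.
The inverse case needs that a point mapped into `Λ̄` already lies in `Λ̄`. -/
lemma exists_implements {S : OpenPartialHomeomorph Λ.X Λ.X} (hS : Pseudogroup Λ.generators S) :
    ∃ q, opOf q ∈ Λ.toeplitz ∧ Λ.Implements S q := by
  induction hS with
  | of S hS =>
    obtain ⟨a, b, f, rfl | rfl⟩ := hS
    · exact ⟨_, Λ.L_mem f, Λ.implements_gelfandHomeo _ _⟩
    · exact ⟨_, Λ.R_mem f, Λ.implements_gelfandHomeo _ _⟩
  | refl =>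
    refine ⟨PEquiv.refl _, ?_, fun μ => ⟨fun _ => ⟨μ, rfl⟩, fun ν h => ⟨trivial, ?_⟩⟩⟩
    · rw [opOf_refl]
      exact Λ.one_mem_toeplitz
    · exact congrArg Λ.point (Option.some.inj h)
  | trans S T _ _ ihS ihT =>
    obtain ⟨q, hq, hSq⟩ := ihS
    obtain ⟨p, hp, hTp⟩ := ihT
    refine ⟨q.trans p, ?_, fun μ => ⟨fun h => ?_, fun ν h => ?_⟩⟩
    · rw [← opOf_mul]
      exact mul_mem hp hq
    · rw [OpenPartialHomeomorph.trans_source] at h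
      obtain ⟨ν, hν⟩ := (hSq μ).1 h.1
      have h₂ := h.2
      rw [Set.mem_preimage, ((hSq μ).2 ν hν).2] at h₂
      obtain ⟨κ, hκ⟩ := (hTp ν).1 h₂
      exact ⟨κ, (PEquiv.trans_eq_some q p μ κ).2 ⟨ν, hν, hκ⟩⟩
    · obtain ⟨κ, hκ, hκ'⟩ := (PEquiv.trans_eq_some q p μ ν).1 h
      obtain ⟨h₁, h₂⟩ := (hSq μ).2 κ hκ
      obtain ⟨h₃, h₄⟩ := (hTp κ).2 ν hκ'
      rw [OpenPartialHomeomorph.trans_source, OpenPartialHomeomorph.trans_apply, h₂, h₄]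
      exact ⟨⟨h₁, by rwa [Set.mem_preimage, h₂]⟩, rfl⟩
  | symm S _ ih =>
    obtain ⟨q, hq, hSq⟩ := ih
    refine ⟨q.symm, symm_mem hq, fun μ => ⟨fun h => ?_, fun ν h => ?_⟩⟩
    · have hs : S.symm (Λ.point μ) ∈ S.source := S.map_target h
      have hr : S (S.symm (Λ.point μ)) = Λ.point μ := S.right_inv h
      obtain ⟨ν, hν⟩ := Λ.mem_barSet_of_apply_mem hs ⟨μ, hr.symm⟩
      rw [← hν] at hs hr
      obtain ⟨κ, hκ⟩ := (hSq ν).1 hs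
      have : κ = μ := Λ.point_injective (((hSq ν).2 κ hκ).2.symm.trans hr)
      exact ⟨ν, (PEquiv.eq_some_iff q).2 (this ▸ hκ)⟩
    · obtain ⟨h₁, h₂⟩ := (hSq ν).2 μ ((PEquiv.eq_some_iff q).1 h)
      rw [← h₂]
      exact ⟨S.map_source h₁, S.left_inv h₁⟩

/-! ### The reduction of the groupoid to `Λ̄` -/

lemma rng_mem_barSet {γ : Λ.G} (h : γ.src ∈ Λ.barSet) : γ.rng ∈ Λ.barSet := by
  induction γ using Germ.ind with
  | h S hS y hy =>
    obtain ⟨μ, hμ⟩ := h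
    change Λ.point μ = y at hμ
    subst hμ
    obtain ⟨q, -, hq⟩ := Λ.exists_implements hS
    obtain ⟨ν, hν⟩ := (hq μ).1 hy
    exact ⟨ν, ((hq μ).2 ν hν).2.symm⟩

lemma src_mem_barSet {γ : Λ.G} (h : γ.rng ∈ Λ.barSet) : γ.src ∈ Λ.barSet := by
  rw [← γ.rng_inv]
  refine Λ.rng_mem_barSet ?_
  rwa [γ.src_inv]

/-- At an isolated point a germ is only the value there. -/
lemma germ_eq_of_src_mem {γ γ' : Λ.G} {μ : Λ.Bar} (h : γ.src = Λ.point μ)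
    (hs : γ.src = γ'.src) (hr : γ.rng = γ'.rng) : γ = γ' := by
  induction γ using Germ.ind with
  | h S hS y hy =>
    induction γ' using Germ.ind with
    | h T hT z hz =>
      change y = Λ.point μ at h
      change y = z at hs
      change S y = T z at hr
      subst hs h
      refine Germ.mk_eq_mk.2 ⟨rfl, ?_⟩
      rw [Λ.nhds_point, Filter.EventuallyEq, Filter.eventually_pure]
      exact hr

/-- Transitivity comes from `λ Ω = λ`: the germ of `l_λ` at `Ω` ends at `λ`. -/
lemma exists_germ_from_vac (μ : Λ.Bar) :
    ∃ γ : Λ.G, γ.src = Λ.point Bar.vac ∧ γ.rng = Λ.point μ := by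
  cases μ with
  | vac => exact ⟨Germ.mk _ Pseudogroup.refl (Λ.point Bar.vac) trivial, rfl, rfl⟩
  | mor f hf =>
    have h : Λ.left f Bar.vac = some (Bar.mor f hf) := by
      rw [← Λ.toBar_of_ne hf]
      rfl
    obtain ⟨h₁, h₂⟩ := (Λ.implements_gelfandHomeo (Λ.left f) (Λ.L_mem f) Bar.vac).2 _ h
    exact ⟨Germ.mk _ (Pseudogroup.of _ ⟨_, _, f, Or.inl rfl⟩) _ h₁, rfl, h₂⟩

lemma exists_germ (μ ν : Λ.Bar) : ∃ γ : Λ.G, γ.src = Λ.point μ ∧ γ.rng = Λ.point ν := by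
  obtain ⟨α, hα, hα'⟩ := Λ.exists_germ_from_vac ν
  obtain ⟨β, hβ, hβ'⟩ := Λ.exists_germ_from_vac μ
  refine ⟨α.mul β.inv (hα.trans (hβ.symm.trans β.rng_inv.symm)), ?_, ?_⟩
  · rw [Germ.src_mul, Germ.src_inv, hβ']
  · rw [Germ.rng_mul, hα']

/-- The unique germ with source `μ` and range `ν`. -/
def arrow (μ ν : Λ.Bar) : Λ.G := (Λ.exists_germ μ ν).choose

lemma src_arrow (μ ν : Λ.Bar) : (Λ.arrow μ ν).src = Λ.point μ :=
  (Λ.exists_germ μ ν).choose_spec.1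

lemma rng_arrow (μ ν : Λ.Bar) : (Λ.arrow μ ν).rng = Λ.point ν :=
  (Λ.exists_germ μ ν).choose_spec.2

lemma eq_arrow {γ : Λ.G} {μ ν : Λ.Bar} (hs : γ.src = Λ.point μ) (hr : γ.rng = Λ.point ν) :
    γ = Λ.arrow μ ν :=
  Λ.germ_eq_of_src_mem hs (hs.trans (Λ.src_arrow μ ν).symm) (hr.trans (Λ.rng_arrow μ ν).symm)

lemma arrow_injective (μ : Λ.Bar) : Function.Injective (Λ.arrow μ) := by
  intro ν κ h
  apply Λ.point_injective
  rw [← Λ.rng_arrow μ ν, h, rng_arrow]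

lemma isOpen_singleton_arrow (μ ν : Λ.Bar) : IsOpen {Λ.arrow μ ν} := by
  obtain ⟨S, hS, y, hy, e⟩ : ∃ S hS y hy, Λ.arrow μ ν = Germ.mk S hS y hy := by
    induction Λ.arrow μ ν using Germ.ind with
    | h S hS y hy => exact ⟨S, hS, y, hy, rfl⟩
  have hm : Λ.arrow μ ν ∈ Germ.bisection S hS := by
    rw [e]
    exact ⟨⟨y, hy⟩, rfl⟩
  have : {Λ.arrow μ ν} = Germ.bisection S hS ∩ Germ.src ⁻¹' {Λ.point μ} := by
    ext γ
    constructor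
    · rintro rfl
      exact ⟨hm, Λ.src_arrow μ ν⟩
    · rintro ⟨h₁, h₂⟩
      exact Germ.injOn_src_bisection S hS h₁ hm (h₂.trans (Λ.src_arrow μ ν).symm)
  rw [this]
  exact (Germ.isOpen_bisection S hS).inter
    ((Λ.isOpen_singleton_point μ).preimage Germ.continuous_src)

/-! ### The operators of `C_c(G)` on `ℓ²(Λ̄)` -/

/-- On the germs of `S`, the weighted function depends only on the source and so becomes a function
`F` on `X`, continuous because the support of `h` stays where the germ of `S` lies in `U`. If `D`
has diagonal `F` and `q` implements `S`, then `B = opOf q * D`. -/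
lemma exists_toeplitz_of_subordinate {U : Set Λ.G} (hUs : Set.InjOn Germ.src U)
    {f : Λ.G → ℂ} (hf : ContinuousOn f U) (hfU : ∀ γ ∉ U, f γ = 0)
    {S : OpenPartialHomeomorph Λ.X Λ.X} (hS : Pseudogroup Λ.generators S) (hU : IsOpen U)
    (h : C(Λ.X, ℝ)) (hh : tsupport h ⊆ Germ.domainIn S hS U) :
    ∃ B ∈ Λ.toeplitz, ∀ μ ν, B (δ μ) ν = h (Λ.point μ) * f (Λ.arrow μ ν) := by
  classical
  let F : Λ.X → ℂ := fun x => if hx : x ∈ S.source then h x * f (Germ.mk S hS x hx) else 0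
  have hF0 : ∀ x, h x = 0 → F x = 0 := by
    intro x hx
    simp [F, hx]
  have hFW : ContinuousOn F (Germ.domainIn S hS U) := by
    rw [continuousOn_iff_continuous_domRestrict]
    have hsub : ∀ x : Germ.domainIn S hS U, x.1 ∈ S.source := by
      rintro ⟨_, x, hx, rfl⟩
      exact x.2
    have hc : Continuous fun x : Germ.domainIn S hS U => Germ.mk S hS x.1 (hsub x) :=
      (Germ.continuous_mk S hS).comp (continuous_subtype_val.subtype_mk hsub)
    have hc' := hf.comp_continuous hc (by
      rintro ⟨_, x, hx, rfl⟩
      exact hx)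
    have hc'' : Continuous fun x : Germ.domainIn S hS U =>
        (h x.1 : ℂ) * f (Germ.mk S hS x.1 (hsub x)) :=
      (Complex.continuous_ofReal.comp (h.continuous.comp continuous_subtype_val)).mul hc'
    refine hc''.congr fun x => ?_
    simp [F, hsub x]
  have hFc : Continuous F := by
    rw [continuous_iff_continuousAt]
    intro x
    by_cases hx : x ∈ tsupport h
    · exact hFW.continuousAt ((Germ.isOpen_domainIn S hS hU).mem_nhds (hh hx))
    · have : F =ᶠ[nhds x] fun _ => 0 := by
        filter_upwards [(isClosed_tsupport h).isOpen_compl.mem_nhds hx] with y hy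
        exact hF0 y (image_eq_zero_of_notMem_tsupport hy)
      exact continuousAt_const.congr this.symm
  obtain ⟨D, hD⟩ := exists_diag_of_continuous Λ.isClosed_toeplitz Λ.one_mem_toeplitz ⟨F, hFc⟩
  obtain ⟨q, hq, hSq⟩ := Λ.exists_implements hS
  refine ⟨opOf q * D.1, mul_mem hq D.2.1, fun μ ν => ?_⟩
  have hDμ : D.1 (δ μ) μ = F (Λ.point μ) := hD (Λ.point μ)
  rw [mul_apply_eq_comp, diag_apply_delta D.2.2, hDμ, map_smul, lp.coeFn_smul, Pi.smul_apply,
    smul_eq_mul, opOf_delta_apply]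
  by_cases hμ : h (Λ.point μ) = 0
  · rw [hF0 _ hμ, hμ]
    simp
  · obtain ⟨⟨x, hxS⟩, hxU, hx⟩ := hh (subset_tsupport h hμ)
    change x = Λ.point μ at hx
    subst hx
    obtain ⟨κ, hκ⟩ := (hSq μ).1 hxS
    have e : Germ.mk S hS (Λ.point μ) hxS = Λ.arrow μ κ :=
      Λ.eq_arrow rfl ((hSq μ).2 κ hκ).2
    have hFμ : F (Λ.point μ) = h (Λ.point μ) * f (Λ.arrow μ κ) := by
      simp only [F, dif_pos hxS, e]
    have hκU : Λ.arrow μ κ ∈ U := e ▸ hxU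
    by_cases hν : κ = ν
    · subst hν
      rw [if_pos hκ, mul_one, hFμ]
    -- `U` already contains the germ `arrow μ κ` with source `μ`, and its source map is injective.
    · have : Λ.arrow μ ν ∉ U := fun hm => hν (Λ.arrow_injective μ
        (hUs hκU hm ((Λ.src_arrow μ κ).trans (Λ.src_arrow μ ν).symm)))
      rw [hfU _ this, if_neg]
      · simp
      · rw [hκ]
        exact fun h => hν (Option.some.inj h)

/-- The partition of unity is taken on the compact Hausdorff space `X`, over the source image of
`K`, since `G` need not be Hausdorff. The weights sum to 1 on that image, and `f` vanishes off `K`.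
-/
lemma exists_toeplitz_of_bisection {U K : Set Λ.G} (hU : IsOpen U) (hUs : Set.InjOn Germ.src U)
    {f : Λ.G → ℂ} (hf : ContinuousOn f U) (hK : IsCompact K) (hKU : K ⊆ U)
    (hfK : ∀ γ ∉ K, f γ = 0) :
    ∃ B ∈ Λ.toeplitz, ∀ μ ν, B (δ μ) ν = f (Λ.arrow μ ν) := by
  have hex : ∀ γ : Λ.G, ∃ (S : OpenPartialHomeomorph Λ.X Λ.X) (hS : Pseudogroup Λ.generators S),
      γ ∈ U → γ.src ∈ Germ.domainIn S hS U := by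
    intro γ
    induction γ using Germ.ind with
    | h S hS y hy => exact ⟨S, hS, fun h => ⟨⟨y, hy⟩, h, rfl⟩⟩
  choose S hS hSU using hex
  obtain ⟨t, ht⟩ := (hK.image Germ.continuous_src).elim_finite_subcover
    (fun γ : Λ.G => Germ.domainIn (S γ) (hS γ) U) (fun γ => Germ.isOpen_domainIn _ _ hU) (by
      rintro _ ⟨γ, hγ, rfl⟩
      exact Set.mem_iUnion.2 ⟨γ, hSU γ (hKU hγ)⟩)
  let e := t.equivFin.symm
  obtain ⟨h, hsupp, hsum, -, -⟩ := exists_continuous_sum_one_of_isOpen_isCompact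
    (s := fun i => Germ.domainIn (S (e i)) (hS (e i)) U)
    (fun i => Germ.isOpen_domainIn _ _ hU) (hK.image Germ.continuous_src) (by
      intro x hx
      obtain ⟨γ, hγ, hxγ⟩ := Set.mem_iUnion₂.1 (ht hx)
      refine Set.mem_iUnion.2 ⟨e.symm ⟨γ, hγ⟩, ?_⟩
      rw [e.apply_symm_apply]
      exact hxγ)
  choose B hB hBf using fun i => Λ.exists_toeplitz_of_subordinate hUs hf
    (fun γ hγ => hfK γ fun h => hγ (hKU h)) (hS (e i)) hU (h i) (hsupp i)
  refine ⟨∑ i, B i, sum_mem fun i _ => hB i, fun μ ν => ?_⟩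
  have hE : (∑ i, B i) (δ μ) ν = ∑ i, B i (δ μ) ν := by
    rw [sum_apply, lp.coeFn_sum, Finset.sum_apply]
  rw [hE]
  simp only [hBf]
  rw [← Finset.sum_mul]
  by_cases hfγ : Λ.arrow μ ν ∈ K
  · have := hsum ⟨_, hfγ, Λ.src_arrow μ ν⟩
    rw [Finset.sum_apply] at this
    rw [← Complex.ofReal_sum, this]
    simp
  · rw [hfK _ hfγ, mul_zero]

lemma exists_toeplitz_of_mem_Cc {f : Λ.G → ℂ} (hf : f ∈ Cc Λ.generators) :
    ∃ B ∈ Λ.toeplitz, ∀ μ ν, B (δ μ) ν = f (Λ.arrow μ ν) := by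
  induction hf using Submodule.span_induction with
  | mem f hf =>
    obtain ⟨U, hU, hUs, -, hfU, K, hKU, hK, hfK⟩ := hf
    exact Λ.exists_toeplitz_of_bisection hU hUs hfU hK hKU hfK
  | zero => exact ⟨0, zero_mem _, fun μ ν => by simp⟩
  | add f g _ _ hf hg =>
    obtain ⟨B, hB, hBf⟩ := hf
    obtain ⟨C, hC, hCg⟩ := hg
    exact ⟨B + C, add_mem hB hC, fun μ ν => by simp [hBf, hCg]⟩
  | smul c f _ hf =>
    obtain ⟨B, hB, hBf⟩ := hf
    exact ⟨c • B, SMulMemClass.smul_mem c hB, fun μ ν => by simp [hBf]⟩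

end HigherRankGraph

/-! ### Isometries of injections -/

section Lift

variable {ι κ : Type w}

lemma orthonormal_delta_comp {j : ι → κ} (hj : Function.Injective j) :
    Orthonormal ℂ fun i => (δ (j i) : L2 κ) := by
  classical
  rw [orthonormal_iff_ite]
  intro i i'
  rw [inner_delta]
  by_cases h : i = i'
  · subst h
    simp [δ_self]
  · rw [δ_of_ne fun e => h (hj e), if_neg h]

/-- The isometry `δ_i ↦ δ_{j(i)}` of an injective map `j`. -/
def lift (j : ι → κ) (hj : Function.Injective j) : L2 ι →L[ℂ] L2 κ :=
  (orthonormal_delta_comp hj).orthogonalFamily.linearIsometry.toContinuousLinearMap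

variable (j : ι → κ) (hj : Function.Injective j)

lemma lift_delta (i : ι) : lift j hj (δ i) = δ (j i) := by
  classical
  refine ((orthonormal_delta_comp hj).orthogonalFamily.linearIsometry_apply_single 1).trans ?_
  simp

lemma adjoint_lift_apply (ξ : L2 κ) (i : ι) : (lift j hj).adjoint ξ i = ξ (j i) := by
  rw [← inner_delta, ContinuousLinearMap.adjoint_inner_right, lift_delta, inner_delta]

lemma adjoint_lift_comp_lift : (lift j hj).adjoint ∘L lift j hj = ContinuousLinearMap.id ℂ _ := by
  refine op_ext fun i i' => ?_
  rw [ContinuousLinearMap.comp_apply, adjoint_lift_apply, lift_delta]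
  by_cases h : i' = i
  · subst h
    simp [δ_self]
  · rw [δ_of_ne fun e => h (hj e)]
    simp [δ_of_ne h]

lemma adjoint_lift_lift (η : L2 ι) : (lift j hj).adjoint (lift j hj η) = η :=
  DFunLike.congr_fun (adjoint_lift_comp_lift j hj) η

lemma lift_apply (η : L2 ι) (i : ι) : lift j hj η (j i) = η i := by
  rw [← adjoint_lift_apply j hj, adjoint_lift_lift]

lemma lift_apply_of_notMem (η : L2 ι) {k : κ} (hk : ∀ i, k ≠ j i) : lift j hj η k = 0 := by
  rw [← inner_delta, ← ContinuousLinearMap.adjoint_inner_left]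
  have : (lift j hj).adjoint (δ k) = 0 := by
    ext i
    rw [adjoint_lift_apply, δ_of_ne (hk i).symm]
    rfl
  rw [this, inner_zero_left]

end Lift

lemma opOf_single_apply {ι : Type w} [DecidableEq ι] (i j : ι) (ξ : L2 ι) :
    opOf (PEquiv.single i j) ξ = ξ i • δ j := by
  ext k
  rw [opOf_apply, PEquiv.symm_single]
  by_cases h : k = j
  · subst h
    simp [PEquiv.single_apply, δ_self]
  · simp [PEquiv.single_apply_of_ne (Ne.symm h), δ_of_ne h]

lemma opOf_single_mul_mul {ι : Type w} [DecidableEq ι] (i j : ι) (B : Op ι) :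
    opOf (PEquiv.single j j) * B * opOf (PEquiv.single i i) =
      B (δ i) j • opOf (PEquiv.single i j) := by
  ext1 ξ
  simp only [mul_apply_eq_comp, opOf_single_apply, map_smul, smul_apply]
  rw [smul_comm]

namespace HigherRankGraph

variable {r : ℕ} {V : Type u} [Category.{v} V] (Λ : HigherRankGraph r V)
variable [NeZero r] [Λ.IsFinitary]

/-! ### The regular representation at a point of `Λ̄` -/

/-- The isometry of `ℓ²(Λ̄)` onto `ℓ²(G_z)`, for `z ∈ Λ̄`. -/
def fiberLift (z : Λ.Bar) : L2 Λ.Bar →L[ℂ] L2 Λ.G := lift (Λ.arrow z) (Λ.arrow_injective z)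

/-- The compression of an operator on `ℓ²(G)` to the fibre over `Ω`. -/
def compress (T : Op Λ.G) : Op Λ.Bar :=
  (Λ.fiberLift Bar.vac).adjoint ∘L T ∘L Λ.fiberLift Bar.vac

lemma compress_apply (T : Op Λ.G) (μ ν : Λ.Bar) :
    Λ.compress T (δ μ) ν = T (δ (Λ.arrow Bar.vac μ)) (Λ.arrow Bar.vac ν) := by
  simp [compress, fiberLift, adjoint_lift_apply, lift_delta]

lemma continuous_compress : Continuous Λ.compress := by
  unfold compress
  fun_prop

lemma compress_star (T : Op Λ.G) : Λ.compress (star T) = star (Λ.compress T) := by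
  refine op_ext fun μ ν => ?_
  rw [compress_apply, star_apply_delta, star_apply_delta, compress_apply]

/-- With `J` the isometry of the fibre, `T J = J (J* T J)` gives `J* S T J = (J* S J)(J* T J)`; only
the right factor has to preserve the fibre. -/
lemma compress_mul (S : Op Λ.G) {T : Op Λ.G}
    (hT : T ∘L Λ.fiberLift Bar.vac = Λ.fiberLift Bar.vac ∘L Λ.compress T) :
    Λ.compress (S * T) = Λ.compress S * Λ.compress T := by
  ext1 ξ
  have h := DFunLike.congr_fun hT ξ
  simp only [ContinuousLinearMap.comp_apply] at h
  rw [compress, mul_apply_eq_comp]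
  simp only [ContinuousLinearMap.comp_apply, mul_apply_eq_comp]
  rw [h]
  rfl

lemma compress_add (S T : Op Λ.G) : Λ.compress (S + T) = Λ.compress S + Λ.compress T := by
  simp [compress]

lemma compress_smul (c : ℂ) (T : Op Λ.G) : Λ.compress (c • T) = c • Λ.compress T := by
  simp [compress]

lemma compress_zero : Λ.compress 0 = 0 := by
  simp [compress]

/-- `h₁` makes `T` block diagonal over sources, and `h₂` makes the blocks over `Λ̄` equal. By
invariance of `Λ̄`, the fibre over `z` consists exactly of the germs `arrow z ν`. -/
lemma comp_fiberLift {T : Op Λ.G} (h₁ : ∀ α β, Germ.src α ≠ β.src → T (δ β) α = 0)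
    (h₂ : ∀ z μ ν, T (δ (Λ.arrow z μ)) (Λ.arrow z ν) =
      T (δ (Λ.arrow Bar.vac μ)) (Λ.arrow Bar.vac ν)) (z : Λ.Bar) :
    T ∘L Λ.fiberLift z = Λ.fiberLift z ∘L Λ.compress T := by
  refine op_ext fun μ α => ?_
  rw [ContinuousLinearMap.comp_apply, ContinuousLinearMap.comp_apply, fiberLift, lift_delta]
  by_cases hα : Germ.src α = Λ.point z
  · obtain ⟨ν, hν⟩ := Λ.rng_mem_barSet (γ := α) ⟨z, hα.symm⟩
    rw [Λ.eq_arrow hα hν.symm, lift_apply, h₂, compress_apply]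
  · rw [h₁ _ _ (by rwa [src_arrow]), lift_apply_of_notMem]
    rintro ν rfl
    exact hα (Λ.src_arrow z ν)

/-- The product of `arrow z ν` with the inverse of `arrow z μ` is `arrow μ ν`, whatever `z` is. -/
lemma regularOp_arrow {f : Λ.G → ℂ} {T : Op Λ.G} (hT : IsRegularOp f T) (z μ ν : Λ.Bar) :
    T (δ (Λ.arrow z μ)) (Λ.arrow z ν) = f (Λ.arrow μ ν) := by
  rw [hT, dif_pos ((Λ.src_arrow z ν).trans (Λ.src_arrow z μ).symm)]
  congr 1
  refine Λ.eq_arrow ?_ ?_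
  · rw [Germ.src_mul, Germ.src_inv, rng_arrow]
  · rw [Germ.rng_mul, rng_arrow]

lemma compress_regularOp {f : Λ.G → ℂ} {T : Op Λ.G} (hT : IsRegularOp f T) (μ ν : Λ.Bar) :
    Λ.compress T (δ μ) ν = f (Λ.arrow μ ν) := by
  rw [compress_apply, Λ.regularOp_arrow hT]

/-- The operators on `ℓ²(G)` which, together with their adjoints, act in the same way on the fibres
over all points of `Λ̄`, namely by an operator of the Toeplitz algebra. -/
def fiberwiseOps : NonUnitalStarSubalgebra ℂ (Op Λ.G) where
  carrier := {T | (∀ z, T ∘L Λ.fiberLift z = Λ.fiberLift z ∘L Λ.compress T) ∧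
    (∀ z, star T ∘L Λ.fiberLift z = Λ.fiberLift z ∘L Λ.compress (star T)) ∧
    Λ.compress T ∈ Λ.toeplitz}
  zero_mem' := by
    refine ⟨fun z => ?_, fun z => ?_, ?_⟩
    · simp [compress_zero]
    · simp [compress_zero]
    · rw [compress_zero]
      exact zero_mem _
  add_mem' := by
    rintro S T ⟨hS, hS', hSt⟩ ⟨hT, hT', hTt⟩
    refine ⟨fun z => ?_, fun z => ?_, ?_⟩
    · rw [compress_add, ContinuousLinearMap.add_comp, hS, hT, ContinuousLinearMap.comp_add]
    · rw [star_add, compress_add, ContinuousLinearMap.add_comp, hS', hT',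
        ContinuousLinearMap.comp_add]
    · rw [compress_add]
      exact add_mem hSt hTt
  mul_mem' := by
    rintro S T ⟨hS, hS', hSt⟩ ⟨hT, hT', hTt⟩
    -- Stated for arbitrary operators because it is applied again to the adjoints, in reverse order.
    have h : ∀ S T : Op Λ.G, (∀ z, S ∘L Λ.fiberLift z = Λ.fiberLift z ∘L Λ.compress S) →
        (∀ z, T ∘L Λ.fiberLift z = Λ.fiberLift z ∘L Λ.compress T) →
        ∀ z, (S * T) ∘L Λ.fiberLift z = Λ.fiberLift z ∘L Λ.compress (S * T) := by
      intro S T hS hT z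
      rw [Λ.compress_mul S (hT _)]
      rw [ContinuousLinearMap.mul_def, ContinuousLinearMap.mul_def,
        ContinuousLinearMap.comp_assoc, hT, ← ContinuousLinearMap.comp_assoc, hS,
        ContinuousLinearMap.comp_assoc]
    refine ⟨h S T hS hT, ?_, ?_⟩
    · rw [star_mul]
      exact h _ _ hT' hS'
    · rw [Λ.compress_mul S (hT _)]
      exact mul_mem hSt hTt
  smul_mem' := by
    rintro c T ⟨hT, hT', hTt⟩
    refine ⟨fun z => ?_, fun z => ?_, ?_⟩
    · rw [compress_smul, ContinuousLinearMap.smul_comp, hT, ContinuousLinearMap.comp_smul]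
    · rw [star_smul, compress_smul, ContinuousLinearMap.smul_comp, hT',
        ContinuousLinearMap.comp_smul]
    · rw [compress_smul]
      exact SMulMemClass.smul_mem c hTt
  star_mem' := by
    rintro T ⟨hT, hT', hTt⟩
    refine ⟨hT', ?_, ?_⟩
    · rwa [star_star]
    · rw [compress_star]
      exact star_mem hTt

lemma isClosed_fiberwiseOps : IsClosed (Λ.fiberwiseOps : Set (Op Λ.G)) := by
  have hc := Λ.continuous_compress
  have h₁ : ∀ z, IsClosed {T : Op Λ.G | T ∘L Λ.fiberLift z = Λ.fiberLift z ∘L Λ.compress T} :=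
    fun z => isClosed_eq (by fun_prop) (by fun_prop)
  have h₂ : ∀ z, IsClosed {T : Op Λ.G |
      star T ∘L Λ.fiberLift z = Λ.fiberLift z ∘L Λ.compress (star T)} :=
    fun z => (h₁ z).preimage continuous_star
  have : (Λ.fiberwiseOps : Set (Op Λ.G)) =
      (⋂ z, {T : Op Λ.G | T ∘L Λ.fiberLift z = Λ.fiberLift z ∘L Λ.compress T}) ∩
      ((⋂ z, {T : Op Λ.G | star T ∘L Λ.fiberLift z = Λ.fiberLift z ∘L Λ.compress (star T)}) ∩
        Λ.compress ⁻¹' Λ.toeplitz) := by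
    ext T
    simp only [Set.mem_inter_iff, Set.mem_iInter]
    rfl
  rw [this]
  exact (isClosed_iInter h₁).inter ((isClosed_iInter h₂).inter (Λ.isClosed_toeplitz.preimage hc))

lemma regularOp_mem_fiberwiseOps {f : Λ.G → ℂ} (hf : f ∈ Cc Λ.generators) {T : Op Λ.G}
    (hT : IsRegularOp f T) : T ∈ Λ.fiberwiseOps := by
  have h₁ : ∀ α β, Germ.src α ≠ β.src → T (δ β) α = 0 := fun α β h => by
    rw [hT, dif_neg h]
  have h₂ : ∀ z μ ν, T (δ (Λ.arrow z μ)) (Λ.arrow z ν) =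
      T (δ (Λ.arrow Bar.vac μ)) (Λ.arrow Bar.vac ν) := fun z μ ν => by
    rw [Λ.regularOp_arrow hT, Λ.regularOp_arrow hT]
  refine ⟨Λ.comp_fiberLift h₁ h₂, Λ.comp_fiberLift (fun α β h => ?_) (fun z μ ν => ?_), ?_⟩
  · rw [star_apply_delta, h₁ _ _ h.symm, star_zero]
  · rw [star_apply_delta, h₂, star_apply_delta]
  · obtain ⟨B, hB, hBf⟩ := Λ.exists_toeplitz_of_mem_Cc hf
    convert hB
    refine op_ext fun μ ν => ?_
    rw [hBf, Λ.compress_regularOp hT]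

/-- A closed *-subalgebra containing the generators contains `C*_r(G)`. This yields both the
multiplicativity of `compress` on `C*_r(G)` and the inclusion of the range of `π` in `E`. -/
lemma reducedCStar_le_fiberwiseOps : reducedCStar Λ.generators ≤ Λ.fiberwiseOps := by
  refine NonUnitalStarSubalgebra.topologicalClosure_minimal _
    (NonUnitalStarAlgebra.adjoin_le ?_) Λ.isClosed_fiberwiseOps
  rintro T ⟨f, hf, hT⟩
  exact Λ.regularOp_mem_fiberwiseOps hf hT

/-- The regular representation of `C*_r(G)` at `Ω`, on `ℓ²(G_Ω) = ℓ²(Λ̄)`. -/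
def canonicalRep : reducedCStar Λ.generators →⋆ₙₐ[ℂ] Op Λ.Bar where
  toFun T := Λ.compress T.1
  map_smul' c T := Λ.compress_smul c T.1
  map_zero' := Λ.compress_zero
  map_add' S T := Λ.compress_add S.1 T.1
  map_mul' S T := Λ.compress_mul S.1 ((Λ.reducedCStar_le_fiberwiseOps T.2).1 _)
  map_star' T := Λ.compress_star T.1

lemma finsum_arrow (f : Λ.G → ℂ) (μ ν : Λ.Bar) :
    ∑ᶠ (γ : Λ.G) (_ : γ.src = Λ.point μ ∧ γ.rng = Λ.point ν), f γ = f (Λ.arrow μ ν) := by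
  have h : ∀ γ : Λ.G, (γ.src = Λ.point μ ∧ γ.rng = Λ.point ν) ↔ γ ∈ ({Λ.arrow μ ν} : Set Λ.G) := by
    intro γ
    refine ⟨fun h => Λ.eq_arrow h.1 h.2, ?_⟩
    rintro rfl
    exact ⟨Λ.src_arrow μ ν, Λ.rng_arrow μ ν⟩
  simp only [h]
  exact finsum_mem_singleton

lemma isClosed_reducedCStar : IsClosed (reducedCStar Λ.generators : Set (Op Λ.G)) :=
  NonUnitalStarSubalgebra.isClosed_topologicalClosure _

/-! ### The range of the representation -/

/-- A character takes only the values 0 and 1 on the projection `V* V`, so the domain is clopen and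
the germs over it form a compact open bisection. Convolution by its indicator compresses to `V`. -/
lemma exists_compress_eq_opOf {p : Λ.Bar ≃. Λ.Bar} (hp : opOf p ∈ Λ.toeplitz)
    (hg : gelfandHomeo p hp ∈ Λ.generators) :
    ∃ T, ∃ _ : T ∈ reducedCStar Λ.generators, Λ.compress T = opOf p := by
  classical
  have hS : Pseudogroup Λ.generators (gelfandHomeo p hp) := Pseudogroup.of _ hg
  have hcl : IsClosed (gelfandHomeo p hp).source := by
    have : (gelfandHomeo p hp).source = {x | x (initialProj p hp) = 1} := by
      ext x
      refine ⟨fun hx => apply_initialProj_eq_one hx, fun hx => ?_⟩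
      change x (initialProj p hp) ≠ 0
      rw [show x (initialProj p hp) = 1 from hx]
      exact one_ne_zero
    rw [this]
    exact isClosed_eq (continuous_eval _) continuous_const
  have hs := Germ.injOn_src_bisection _ hS
  have hr := Germ.injOn_rng_bisection _ hS
  have hreg := Germ.isRegularOp_indicator hs hr
  refine ⟨_, Germ.mem_reducedCStar (Germ.indicator_mem_Cc (Germ.isOpen_bisection _ hS) hs hr
    (Germ.isCompact_bisection _ hS hcl)) hreg, op_ext fun μ ν => ?_⟩
  rw [Λ.compress_regularOp hreg, opOf_delta_apply, Set.indicator_apply]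
  congr 1
  rw [eq_iff_iff]
  constructor
  · rintro ⟨⟨x, hx⟩, e⟩
    have hxμ : x = Λ.point μ := by
      rw [← Λ.src_arrow μ ν, ← e]
      rfl
    subst hxμ
    obtain ⟨κ, hκ⟩ := (Λ.implements_gelfandHomeo p hp μ).1 hx
    rw [hκ]
    congr 1
    apply Λ.point_injective
    rw [← ((Λ.implements_gelfandHomeo p hp μ).2 κ hκ).2, ← Λ.rng_arrow μ ν, ← e]
    rfl
  · intro h
    obtain ⟨h₁, h₂⟩ := (Λ.implements_gelfandHomeo p hp μ).2 ν h
    exact ⟨⟨_, h₁⟩, Λ.eq_arrow rfl h₂⟩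

lemma exists_compress_eq_generator {B : Op Λ.Bar}
    (hB : ∃ (a b : V) (f : a ⟶ b), Λ.shape f ≠ 0 ∧ (B = Λ.L f ∨ B = Λ.R f)) :
    ∃ T, ∃ _ : T ∈ reducedCStar Λ.generators, Λ.compress T = B := by
  obtain ⟨a, b, f, -, h | h⟩ := hB
  · rw [h]
    exact Λ.exists_compress_eq_opOf (p := Λ.left f) (Λ.L_mem f) ⟨a, b, f, Or.inl rfl⟩
  · rw [h]
    exact Λ.exists_compress_eq_opOf (p := Λ.right f) (Λ.R_mem f) ⟨a, b, f, Or.inr rfl⟩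

/-! ### Matrix units -/

/-- Left multiplication by the germ from `μ` to `ν`. -/
def arrowMul (μ ν : Λ.Bar) : Λ.G ≃. Λ.G :=
  Germ.leftMul {Λ.arrow μ ν} (Set.injOn_singleton _ _) (Set.injOn_singleton _ _)

lemma isRegularOp_arrowMul (μ ν : Λ.Bar) :
    IsRegularOp (({Λ.arrow μ ν} : Set Λ.G).indicator 1) (opOf (Λ.arrowMul μ ν)) :=
  Germ.isRegularOp_indicator _ _

lemma indicator_arrow_mem_Cc (μ ν : Λ.Bar) :
    ({Λ.arrow μ ν} : Set Λ.G).indicator 1 ∈ Cc Λ.generators :=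
  Germ.indicator_mem_Cc (Λ.isOpen_singleton_arrow μ ν) (Set.injOn_singleton _ _)
    (Set.injOn_singleton _ _) isCompact_singleton

lemma opOf_arrowMul_mem_reducedCStar (μ ν : Λ.Bar) :
    opOf (Λ.arrowMul μ ν) ∈ reducedCStar Λ.generators :=
  Germ.mem_reducedCStar (Λ.indicator_arrow_mem_Cc μ ν) (Λ.isRegularOp_arrowMul μ ν)

lemma opOf_arrowMul_delta_of_ne {μ ν : Λ.Bar} {β : Λ.G} (h : β.rng ≠ Λ.point μ) :
    opOf (Λ.arrowMul μ ν) (δ β) = 0 := by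
  rw [opOf_single]
  cases e : Λ.arrowMul μ ν β with
  | none => rfl
  | some α =>
    obtain ⟨γ, rfl, hγ, -⟩ := (Germ.leftMul_eq_some _ _).1 e
    exact absurd (hγ.symm.trans (Λ.src_arrow μ ν)) h

lemma mem_barSet_of_indicator_arrow_ne_zero {μ ν : Λ.Bar} {γ : Λ.G}
    (h : ({Λ.arrow μ ν} : Set Λ.G).indicator (1 : Λ.G → ℂ) γ ≠ 0) :
    γ.src ∈ Λ.barSet ∧ γ.rng ∈ Λ.barSet := by
  have e : γ = Λ.arrow μ ν := Set.mem_of_indicator_ne_zero (s := {Λ.arrow μ ν}) h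
  rw [e]
  exact ⟨⟨μ, (Λ.src_arrow μ ν).symm⟩, ⟨ν, (Λ.rng_arrow μ ν).symm⟩⟩

open scoped Classical in
lemma indicator_arrow_apply_arrow (μ ν κ τ : Λ.Bar) :
    ({Λ.arrow μ ν} : Set Λ.G).indicator (1 : Λ.G → ℂ) (Λ.arrow κ τ) =
      opOf (PEquiv.single μ ν) (δ κ) τ := by
  rw [Set.indicator_apply, opOf_delta_apply]
  congr 1
  rw [eq_iff_iff, Set.mem_singleton_iff, ← Option.mem_def, PEquiv.mem_single_iff]
  constructor
  · intro h
    constructor <;> apply Λ.point_injective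
    · rw [← Λ.src_arrow κ τ, h, src_arrow]
    · rw [← Λ.rng_arrow κ τ, h, rng_arrow]
  · rintro ⟨rfl, rfl⟩
    rfl

open scoped Classical in
lemma compress_arrowMul (μ ν : Λ.Bar) :
    Λ.compress (opOf (Λ.arrowMul μ ν)) = opOf (PEquiv.single μ ν) := by
  refine op_ext fun κ τ => ?_
  rw [Λ.compress_regularOp (Λ.isRegularOp_arrowMul μ ν), indicator_arrow_apply_arrow]

lemma fiberwise_apply {T : Op Λ.G} (hT : T ∈ Λ.fiberwiseOps) (z μ : Λ.Bar) :
    T (δ (Λ.arrow z μ)) = Λ.fiberLift z (Λ.compress T (δ μ)) := by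
  have h := DFunLike.congr_fun (hT.1 z) (δ μ)
  rw [ContinuousLinearMap.comp_apply, ContinuousLinearMap.comp_apply] at h
  rwa [← lift_delta (Λ.arrow z) (Λ.arrow_injective z)]

/-- The identity is needed in `C*_r(G)` itself, without assuming that `compress` is faithful. Both
sides kill `δ_β` unless `β` ends at `μ`; then `β` starts in `Λ̄`, where fibrewise operators are
determined by their compressions, and the compressed identity is one between matrix units. -/
lemma arrowMul_mul_mul_arrowMul {T : Op Λ.G} (hT : T ∈ Λ.fiberwiseOps) (μ ν : Λ.Bar) :
    opOf (Λ.arrowMul ν ν) * T * opOf (Λ.arrowMul μ μ) =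
      (Λ.compress T (δ μ) ν : ℂ) • opOf (Λ.arrowMul μ ν) := by
  classical
  have hmem : ∀ κ τ, opOf (Λ.arrowMul κ τ) ∈ Λ.fiberwiseOps := fun κ τ =>
    Λ.reducedCStar_le_fiberwiseOps (Λ.opOf_arrowMul_mem_reducedCStar κ τ)
  have hl := mul_mem (mul_mem (hmem ν ν) hT) (hmem μ μ)
  have h : Λ.compress (opOf (Λ.arrowMul ν ν) * T * opOf (Λ.arrowMul μ μ)) =
      (Λ.compress T (δ μ) ν : ℂ) • Λ.compress (opOf (Λ.arrowMul μ ν)) := by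
    rw [Λ.compress_mul _ ((hmem μ μ).1 _), Λ.compress_mul _ (hT.1 _), compress_arrowMul,
      compress_arrowMul, compress_arrowMul, opOf_single_mul_mul]
  refine op_ext fun β α => ?_
  by_cases hβ : β.rng = Λ.point μ
  · obtain ⟨z, hz⟩ := Λ.src_mem_barSet (γ := β) ⟨μ, hβ.symm⟩
    rw [Λ.eq_arrow hz.symm hβ, Λ.fiberwise_apply hl, h, smul_apply, smul_apply, map_smul,
      Λ.fiberwise_apply (hmem μ ν)]
  · rw [mul_apply_eq_comp, smul_apply, Λ.opOf_arrowMul_delta_of_ne hβ,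
      Λ.opOf_arrowMul_delta_of_ne hβ, map_zero, smul_zero]

end HigherRankGraph

/-! ### Uniqueness from matrix units, and surjectivity from generators -/

open scoped Classical in
/-- If `π` sends the elements `e i j` to the matrix units and `e j j * a * e i i` is the multiple of
`e i j` by the matrix entry of `ρ a`, then `π` and `ρ` agree. -/
lemma starHom_eq_of_matrixUnits {ι : Type w} {A : Type*} [NonUnitalNonAssocSemiring A] [Star A]
    [Module ℂ A] {π ρ : A →⋆ₙₐ[ℂ] Op ι} (e : ι → ι → A)
    (hπ : ∀ i j, π (e i j) = opOf (PEquiv.single i j))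
    (h : ∀ a i j, e j j * a * e i i = (ρ a (δ i) j : ℂ) • e i j) : π = ρ := by
  ext1 a
  refine op_ext fun i j => ?_
  have h₁ := congrArg π (h a i j)
  rw [map_mul, map_mul, map_smul, hπ, hπ, hπ, opOf_single_mul_mul] at h₁
  have h₂ := congrArg (fun B : Op ι => B (δ i) j) h₁
  simpa [opOf_single_apply, δ_self] using h₂

/-- The range is a *-subalgebra and is closed, so it suffices to reach the generators. -/
lemma topologicalClosure_adjoin_subset_range {ι κ : Type w} {C : NonUnitalStarSubalgebra ℂ (Op κ)}
    (hC : IsClosed (C : Set (Op κ))) (φ : C →⋆ₙₐ[ℂ] Op ι) (hφ : Continuous φ)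
    {s : Set (Op ι)} (hs : ∀ B ∈ s, ∃ (T : Op κ) (hT : T ∈ C), φ ⟨T, hT⟩ = B) :
    ((NonUnitalStarAlgebra.adjoin ℂ s).topologicalClosure : Set (Op ι)) ⊆ Set.range φ := by
  have hle : (NonUnitalStarAlgebra.adjoin ℂ s).topologicalClosure ≤ NonUnitalStarAlgHom.range φ :=
    NonUnitalStarSubalgebra.topologicalClosure_minimal _ (NonUnitalStarAlgebra.adjoin_le fun B hB =>
      (hs B hB).elim fun T hT => ⟨⟨T, hT.1⟩, hT.2⟩) (isClosed_range_of_continuous φ hφ)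
  exact hle

end

end TwoSidedToeplitz

theorem mainTheorem7 {r : ℕ} [NeZero r] {V : Type u} [CategoryTheory.Category.{v} V]
    (Λ : TwoSidedToeplitz.HigherRankGraph r V) [Λ.IsFinitary] :
    (CompactSpace Λ.X ∧ T2Space Λ.X ∧ Function.Injective Λ.point ∧
      IsOpen Λ.barSet ∧ Dense Λ.barSet ∧ DiscreteTopology Λ.barSet) ∧
    ∃ π : TwoSidedToeplitz.reducedCStar Λ.generators →⋆ₙₐ[ℂ] TwoSidedToeplitz.Op Λ.Bar,
      Λ.IsCanonicalRep π ∧ (∀ π', Λ.IsCanonicalRep π' → π' = π) ∧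
      Set.range π = (Λ.toeplitz : Set (TwoSidedToeplitz.Op Λ.Bar)) := by
  classical
  refine ⟨⟨Λ.compactSpace_X, inferInstance, Λ.point_injective, Λ.isOpen_barSet, Λ.dense_barSet,
    Λ.discreteTopology_barSet⟩, Λ.canonicalRep, ?_, ?_, ?_⟩
  · intro f _ _ T hT μ ν
    exact (Λ.compress_regularOp hT μ ν).trans (Λ.finsum_arrow f μ ν).symm
  · intro π hπ
    refine TwoSidedToeplitz.starHom_eq_of_matrixUnits
      (fun μ ν => ⟨TwoSidedToeplitz.opOf (Λ.arrowMul μ ν), Λ.opOf_arrowMul_mem_reducedCStar μ ν⟩)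
      (fun μ ν => TwoSidedToeplitz.op_ext fun κ τ => ?_)
      (fun T μ ν => Subtype.ext
        (Λ.arrowMul_mul_mul_arrowMul (Λ.reducedCStar_le_fiberwiseOps T.2) μ ν))
    -- The indicator of a single germ over `Λ̄` is supported in the reduction to `Λ̄`, so the
    -- hypothesis on `π` fixes its image.
    rw [hπ _ (Λ.indicator_arrow_mem_Cc μ ν)
      (fun γ hγ => Λ.mem_barSet_of_indicator_arrow_ne_zero hγ) _ (Λ.isRegularOp_arrowMul μ ν),
      Λ.finsum_arrow, Λ.indicator_arrow_apply_arrow]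
  · apply Set.Subset.antisymm
    · rintro _ ⟨T, rfl⟩
      exact (Λ.reducedCStar_le_fiberwiseOps T.2).2.2
    · exact TwoSidedToeplitz.topologicalClosure_adjoin_subset_range Λ.isClosed_reducedCStar
        Λ.canonicalRep (Λ.continuous_compress.comp continuous_subtype_val)
        fun _ hB => Λ.exists_compress_eq_generator hB
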